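/- Let $E$ be a locally compact Polish space with Borel $\sigma$-algebra $\mathscr E$, let $\mathscr B_b(E)$ be the bounded measurable real functions on $E$ and $C_0(E)$ the continuous real functions vanishing at infinity. For every $t\ge 0$ let $q_t$ be a stable conservative $q$-pair: for every $x\in E$, $q_t(x,\cdot)$ is a finite measure on $E$ with $q_t(x,\{x\})=0$, and for every $A\in\mathscr E$, $x\mapsto q_t(x,A)$ is measurable. Put $q_t(x):=q_t(x,E\setminus\{x\})$ and $$L_tf(x):=\int_E\big(f(y)-f(x)\big)\,q_t(x,dy).$$ Assume: $(A_1)$ For each $t\ge 0$ there is a unique homogeneous jump process with $q$-pair $q_t$, i.e. a unique family of transition probability kernels $\{P^{(t)}_s\}_{s\ge 0}$ on $E$ with $P^{(t)}_0(x,\cdot)=\delta_x$, $P^{(t)}_{s+r}=P^{(t)}_sP^{(t)}_r$ for $s,r\ge 0$, $\lim_{s\downarrow 0}P^{(t)}_s(x,\{x\})=1$ for $x\in E$, and, for all $f\in C_0(E)$, $s\ge 0$, pointwise on $E$, $$\partial_sP^{(t)}_sf=L_tP^{(t)}_sf=P^{(t)}_sL_tf,$$ where $P^{(t)}_sf(x):=\int_E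 f(y)P^{(t)}_s(x,dy)$, $L_tf$ is required to be $P^{(t)}_s(x,\cdot)$-integrable, and $\partial_s$ is one-sided at $s=0$. $(A_2)$ For all $T>0$ and $x\in E$, $$\lim_{\varepsilon\downarrow 0}\ \sup_{s,t\in[0,T],\,|t-s|\le\varepsilon}\|q_t(x,\cdot)-q_s(x,\cdot)\|_{var}=0,$$ where $\|\cdot\|_{var}$ is the total variation norm. $(A_3)$ There are a measurable function $V\ge 1$ on $E$, $K\in C([0,\infty);(0,\infty))$ and a constant $\theta>1$ such that for all $t\ge0$, $x\in E$, the function $V^\theta$ is $q_t(x,\cdot)$-integrable and $$q_t(x)\le K(t)V(x),\qquad L_tV^\theta(x)\le K(t)V^\theta(x).$$ Then there exists a unique inhomogeneous Markov jump process generated by $(L_t)_{t\ge0}$, that is, a unique family of transition probability kernels $\{P_{s,t}(x,\cdot):0\le s\le t<\infty,\ x\in E\}$ on $E$ with the following properties, where $P_{s,t}f(x):=\int_Ef(y)P_{s,t}(x,dy)$: 1. $P_{s,s}(x,\cdot)=\delta_x$ for $s\ge 0$, $x\in E$, and the jump condition holds: $\lim_{t\downarrow s}P_{s,t}(x,\{x\})=1$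 for $s\ge 0$ and $\lim_{s\uparrow t}P_{s,t}(x,\{x\})=1$ for $t>0$, $x\in E$; 2. $P_{s,t}=P_{s,r}P_{r,t}$ for $0\le s\le r\le t$; 3. for all $f\in\mathscr B_b(E)$ and $t>s\ge 0$, pointwise on $E$, $$\lim_{\varepsilon\downarrow 0}\frac{P_{s+\varepsilon,t}f-P_{s,t}f}{\varepsilon}=-L_sP_{s,t}f;$$ 4. for all $f\in\mathscr B_b(E)$, $t>s\ge 0$ and $x\in E$, the function $L_tf$ is $P_{s,t}(x,\cdot)$-integrable and $$\lim_{\varepsilon\downarrow 0}\frac{P_{s,t+\varepsilon}f(x)-P_{s,t}f(x)}{\varepsilon}=P_{s,t}L_tf(x).$$ -/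

import Mathlib

open MeasureTheory ProbabilityTheory Filter Topology Set
open scoped ENNReal ZeroAtInfty

noncomputable section

namespace JumpProcess

variable {E : Type*} [MeasurableSpace E]

/-- `f` belongs to the class of bounded measurable real functions on `E`. -/
def BoundedMeasurable (f : E → ℝ) : Prop :=
  Measurable f ∧ ∃ C : ℝ, ∀ x, |f x| ≤ C

/-- The total jump rate `q(x) = q(x, E \ {x})`. -/
def rate (q : Kernel E E) (x : E) : ℝ := (q x).real {x}ᶜ

/-- The operator `L f (x) = ∫ (f y - f x) q(x, dy)`. -/
def gen (q : Kernel E E) (f : E → ℝ) (x : E) : ℝ := ∫ y, (f y - f x) ∂(q x)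

/-- `P f (x) = ∫ f y P(x, dy)`. -/
def act (P : Kernel E E) (f : E → ℝ) (x : E) : ℝ := ∫ y, f y ∂(P x)

/-- The total variation distance `sup_{|f| ≤ 1} |μ(f) - ν(f)|` of two finite measures, the
supremum being over measurable functions. -/
def tvDist (μ ν : Measure E) : ℝ≥0∞ :=
  ⨆ (f : E → ℝ) (_ : Measurable f ∧ ∀ x, |f x| ≤ 1),
    ENNReal.ofReal |(∫ y, f y ∂μ) - ∫ y, f y ∂ν|

/-- For every time `t ≥ 0`, `q t` is a stable conservative q-pair: `q t x` is a finite measure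
without mass at `x` (measurability in `x` is part of `Kernel`). -/
structure IsStableConservative (q : ℝ → Kernel E E) : Prop where
  finite : ∀ t, 0 ≤ t → ∀ x, IsFiniteMeasure (q t x)
  no_self_jump : ∀ t, 0 ≤ t → ∀ x, q t x {x} = 0

/-- `(R s)_{s ≥ 0}` is (the family of transition probability kernels of) a homogeneous jump
process satisfying both Kolmogorov equations for the q-pair `q` on `C₀(E)`,
`∂ₛ Rₛ f = L Rₛ f = Rₛ L f` for `s ≥ 0`. At `s = 0` the derivative is one-sided. -/
structure IsHomogeneousJumpProcess [TopologicalSpace E] (q : Kernel E E) (R : ℝ → Kernel E E) :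
    Prop where
  markov : ∀ s, 0 ≤ s → IsMarkovKernel (R s)
  zero : R 0 = Kernel.id
  semigroup : ∀ s r, 0 ≤ s → 0 ≤ r → R (s + r) = R r ∘ₖ R s
  jump : ∀ x, Tendsto (fun s => R s x {x}) (𝓝[>] 0) (𝓝 1)
  backward : ∀ f : C₀(E, ℝ), ∀ s, 0 ≤ s → ∀ x,
    HasDerivWithinAt (fun u => act (R u) f x) (gen q (act (R s) f) x) (Ici 0) s
  forward : ∀ f : C₀(E, ℝ), ∀ s, 0 ≤ s → ∀ x, Integrable (gen q f) (R s x) ∧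
    HasDerivWithinAt (fun u => act (R u) f x) (act (R s) (gen q f) x) (Ici 0) s

/-- For each frozen time `t ≥ 0` there is a unique homogeneous jump process with q-pair `q t`. -/
def FrozenWellPosed [TopologicalSpace E] (q : ℝ → Kernel E E) : Prop :=
  ∀ t, 0 ≤ t → ∃ R : ℝ → Kernel E E, IsHomogeneousJumpProcess (q t) R ∧
    ∀ R' : ℝ → Kernel E E, IsHomogeneousJumpProcess (q t) R' → ∀ s, 0 ≤ s → R' s = R s

/-- Continuity of `t ↦ q t x` in total variation, uniformly on compact time intervals, for
each `x`. -/
def TimeContinuous (q : ℝ → Kernel E E) : Prop :=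
  ∀ T : ℝ, 0 < T → ∀ x, Tendsto
    (fun ε : ℝ => ⨆ (s ∈ Icc 0 T) (t ∈ Icc 0 T) (_ : |t - s| ≤ ε), tvDist (q t x) (q s x))
    (𝓝[>] 0) (𝓝 0)

/-- There are `V ≥ 1` measurable, `K ∈ C([0,∞); (0,∞))` and `θ > 1` with `q_t ≤ K(t) V` and
`L_t V^θ ≤ K(t) V^θ`. -/
def LyapunovCondition (q : ℝ → Kernel E E) : Prop :=
  ∃ (V : E → ℝ) (K : ℝ → ℝ) (θ : ℝ),
    Measurable V ∧ (∀ x, 1 ≤ V x) ∧ ContinuousOn K (Ici 0) ∧ (∀ t, 0 ≤ t → 0 < K t) ∧ 1 < θ ∧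
    ∀ t, 0 ≤ t → ∀ x, rate (q t) x ≤ K t * V x ∧
      Integrable (fun y => V y ^ θ) (q t x) ∧
      gen (q t) (fun y => V y ^ θ) x ≤ K t * V x ^ θ

/-- `(P s t)_{0 ≤ s ≤ t}` is (the family of transition probability kernels of) an inhomogeneous
Markov jump process generated by the operators `L_t` of `q t`. Values of `P` outside
`0 ≤ s ≤ t` play no role. The fields `jump_right` and `jump_left` say that the process is a
jump process: `P_{s,t}(x,{x}) → 1` as `t ↓ s` and as `s ↑ t`. -/
structure IsGeneratedBy (q : ℝ → Kernel E E) (P : ℝ → ℝ → Kernel E E) : Prop where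
  markov : ∀ s t, 0 ≤ s → s ≤ t → IsMarkovKernel (P s t)
  refl : ∀ s, 0 ≤ s → P s s = Kernel.id
  jump_right : ∀ s, 0 ≤ s → ∀ x, Tendsto (fun t => P s t x {x}) (𝓝[>] s) (𝓝 1)
  jump_left : ∀ t, 0 < t → ∀ x, Tendsto (fun s => P s t x {x}) (𝓝[<] t) (𝓝 1)
  semigroup : ∀ s r t, 0 ≤ s → s ≤ r → r ≤ t → P s t = P r t ∘ₖ P s r
  backward : ∀ f, BoundedMeasurable f → ∀ s t, 0 ≤ s → s < t → ∀ x,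
    Tendsto (fun ε : ℝ => (act (P (s + ε) t) f x - act (P s t) f x) / ε) (𝓝[>] 0)
      (𝓝 (-gen (q s) (act (P s t) f) x))
  forward : ∀ f, BoundedMeasurable f → ∀ s t, 0 ≤ s → s < t → ∀ x,
    Integrable (gen (q t) f) (P s t x) ∧
    Tendsto (fun ε : ℝ => (act (P s (t + ε)) f x - act (P s t) f x) / ε) (𝓝[>] 0)
      (𝓝 (act (P s t) (gen (q t) f) x))

end JumpProcess

end

/-! Everything rests on the backward equation for bounded functions with prescribed value at a
terminal time t. With W = V^θ ≥ V and C the maximum of K on [0, T], the Lyapunov hypothesis becomes: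
the total rate at x is at most C V(x), and L_r W ≤ C W.

Uniqueness is a maximum principle. The rates may be unbounded, so Gronwall does not apply directly.
For a solution w with w_t = 0 and |w| ≤ B, however, the function (B/N) exp(C(t-s)) W is at least B
where V ≥ N, while the rates are at most C N where V < N. Iterating the equation there leaves an
error B (C N (t-s))^k / k!; letting k → ∞ and then N → ∞ gives w ≤ 0
(`IsBackwardSolution.le_of_induction`, `IsBackwardSolution.nonpos`).

Existence is by uniformization: jumps occur at the time-independent rate c = C V, some of them
fictitious (the state does not move), and one sums over the number of jumps (`minimalKernel`).
Decomposing at the first jump gives the backward equation, and the Lyapunov bound makes V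
integrable. Uniqueness then yields total mass one, since the constant 1 is also a solution, and
Chapman–Kolmogorov, since both sides solve the same terminal value problem.

The forward equation follows from P_{s,t+ε} = P_{s,t} P_{t,t+ε}: the quotients (P_{t,t+ε} f - f)/ε
converge to L_t f and are dominated by a multiple of V (`IsLyapunovOn.tendsto_slope_terminal`,
`exists_isGeneratedBy`). -/

noncomputable section

namespace JumpProcess

/-! ### Uniqueness for the backward equation -/

section BackwardEquation

variable {E : Type*} [MeasurableSpace E]

/-- If g a < 0, a line of small positive slope starting at (a, g a) stays negative on [a, b], and g
cannot cross it upwards because g does not increase where it is negative. -/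
theorem nonneg_left_of_deriv_right_nonpos {g g' : ℝ → ℝ} {a b : ℝ} (hab : a ≤ b)
    (hg : ContinuousOn g (Icc a b))
    (hg' : ∀ s ∈ Ico a b, HasDerivWithinAt g (g' s) (Ici s) s)
    (hneg : ∀ s ∈ Ico a b, g s < 0 → g' s ≤ 0) (hb : 0 ≤ g b) : 0 ≤ g a := by
  by_contra! ha
  -- With this slope the line stays below g a / 2 on [a, b]; the summand 1 covers the case a = b.
  set η : ℝ := -g a / (2 * (b - a + 1)) with hη
  have hη0 : 0 < η := div_pos (by linarith) (by linarith)
  have hηb : η * (b - a + 1) = -g a / 2 := by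
    rw [hη]; field_simp [show b - a + 1 ≠ 0 by linarith]
  have key := image_le_of_deriv_right_lt_deriv_boundary hg hg'
    (B := fun s => g a + η * (s - a)) (B' := fun _ => η) (by simp)
    (fun s => by simpa using (((hasDerivAt_id s).sub_const a).const_mul η).const_add (g a))
    (fun s hs h => by
      have h1 : η * (s - a) ≤ η * (b - a + 1) :=
        mul_le_mul_of_nonneg_left (by linarith [hs.2]) hη0.le
      exact (hneg s hs (by rw [h]; linarith)).trans_lt hη0)
    (right_mem_Icc.2 hab)
  have h1 : η * (b - a) ≤ η * (b - a + 1) := mul_le_mul_of_nonneg_left (by linarith) hη0.le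
  linarith

/-- The jump rates on `[0, T]` are dominated by `C * V`, and `W ≥ V ≥ 1` is a Lyapunov function. -/
structure IsLyapunovOn (q : ℝ → Kernel E E) (V W : E → ℝ) (C T : ℝ) : Prop where
  measurable_V : Measurable V
  measurable_W : Measurable W
  one_le : ∀ x, 1 ≤ V x
  V_le_W : ∀ x, V x ≤ W x
  pos : 0 < C
  finite : ∀ t ∈ Icc 0 T, ∀ x, IsFiniteMeasure (q t x)
  mass_le : ∀ t ∈ Icc 0 T, ∀ x, (q t x).real univ ≤ C * V x
  integrable_W : ∀ t ∈ Icc 0 T, ∀ x, Integrable W (q t x)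
  gen_le : ∀ t ∈ Icc 0 T, ∀ x, gen (q t) W x ≤ C * W x

/-- Continuity of `t ↦ q t x` on `[0, T]` in total variation, in terms of test functions. -/
def IsTVContinuousOn (q : ℝ → Kernel E E) (T : ℝ) : Prop :=
  ∀ x, ∀ δ > 0, ∃ η > 0, ∀ s ∈ Icc 0 T, ∀ t ∈ Icc 0 T, |t - s| ≤ η → ∀ f : E → ℝ, Measurable f →
    (∀ y, |f y| ≤ 1) → |(∫ y, f y ∂q t x) - ∫ y, f y ∂q s x| ≤ δ

/-- `u` is a bounded solution on `[0, t]` of the backward equation `∂ₛ uₛ = -Lₛ uₛ`, in the sense of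
right derivatives. -/
structure IsBackwardSolution (q : ℝ → Kernel E E) (t : ℝ) (u : ℝ → E → ℝ) : Prop where
  measurable : ∀ s ∈ Icc 0 t, Measurable (u s)
  bounded : ∃ B, ∀ s ∈ Icc 0 t, ∀ x, |u s x| ≤ B
  continuousOn : ∀ x, ContinuousOn (fun s => u s x) (Icc 0 t)
  hasDeriv : ∀ x, ∀ s ∈ Ico 0 t,
    HasDerivWithinAt (fun r => u r x) (-gen (q s) (u s) x) (Ici s) s

section Gen

variable {q : Kernel E E} {x : E} [IsFiniteMeasure (q x)] {f g : E → ℝ} {B : ℝ}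

theorem integrable_of_abs_le {μ : Measure E} [IsFiniteMeasure μ] (hf : Measurable f)
    (hB : ∀ y, |f y| ≤ B) : Integrable f μ :=
  Integrable.of_bound hf.aestronglyMeasurable B (ae_of_all _ hB)

theorem gen_eq (hf : Integrable f (q x)) :
    gen q f x = (∫ y, f y ∂q x) - (q x).real univ * f x := by
  rw [gen, integral_sub hf (integrable_const _)]; simp

theorem gen_sub (hf : Integrable f (q x)) (hg : Integrable g (q x)) :
    gen q (fun y => f y - g y) x = gen q f x - gen q g x := by
  rw [gen_eq hf, gen_eq hg, gen_eq (f := fun y => f y - g y) (hf.sub hg),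
    integral_sub hf hg]; ring

theorem abs_gen_le (hB : ∀ y, |f y| ≤ B) : |gen q f x| ≤ 2 * B * (q x).real univ := by
  refine norm_integral_le_of_norm_le_const (μ := q x) (f := fun y => f y - f x)
    (ae_of_all _ fun y => ?_)
  rw [Real.norm_eq_abs]
  linarith [abs_sub (f y) (f x), hB y, hB x]

end Gen

variable {q : ℝ → Kernel E E} {V W : E → ℝ} {C T t : ℝ} {u v w : ℝ → E → ℝ}

theorem IsLyapunovOn.mono (h : IsLyapunovOn q V W C T) (ht : t ≤ T) : IsLyapunovOn q V W C t :=
  have h' : Icc 0 t ⊆ Icc 0 T := Icc_subset_Icc_right ht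
  ⟨h.measurable_V, h.measurable_W, h.one_le, h.V_le_W, h.pos, fun s hs => h.finite s (h' hs),
    fun s hs => h.mass_le s (h' hs), fun s hs => h.integrable_W s (h' hs),
    fun s hs => h.gen_le s (h' hs)⟩

theorem IsLyapunovOn.integral_W_le (h : IsLyapunovOn q V W C T) {s : ℝ} (hs : s ∈ Icc 0 T) (x : E) :
    ∫ y, W y ∂q s x ≤ (C + (q s x).real univ) * W x := by
  have := h.finite s hs x
  have h1 := h.gen_le s hs x
  rw [gen_eq (h.integrable_W s hs x)] at h1
  linarith

theorem IsLyapunovOn.integrable_V (h : IsLyapunovOn q V W C T) {s : ℝ} (hs : s ∈ Icc 0 T) (x : E) :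
    Integrable V (q s x) :=
  (h.integrable_W s hs x).mono' h.measurable_V.aestronglyMeasurable (ae_of_all _ fun y => by
    rw [Real.norm_eq_abs, abs_of_nonneg (by linarith [h.one_le y])]; exact h.V_le_W y)

theorem IsBackwardSolution.mono {t' : ℝ} (h : IsBackwardSolution q t u) (ht : t' ≤ t) :
    IsBackwardSolution q t' u := by
  have h' : Icc 0 t' ⊆ Icc 0 t := Icc_subset_Icc_right ht
  obtain ⟨B, hB⟩ := h.bounded
  exact ⟨fun s hs => h.measurable s (h' hs), ⟨B, fun s hs => hB s (h' hs)⟩,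
    fun x => (h.continuousOn x).mono h', fun x s hs => h.hasDeriv x s ⟨hs.1, hs.2.trans_le ht⟩⟩

theorem IsBackwardSolution.sub (hq : ∀ s ∈ Icc 0 t, ∀ x, IsFiniteMeasure (q s x))
    (hu : IsBackwardSolution q t u) (hv : IsBackwardSolution q t v) :
    IsBackwardSolution q t (fun s x => u s x - v s x) := by
  obtain ⟨A, hA⟩ := hu.bounded
  obtain ⟨B, hB⟩ := hv.bounded
  refine ⟨fun s hs => (hu.measurable s hs).sub (hv.measurable s hs), ⟨A + B, fun s hs x => ?_⟩,
    fun x => (hu.continuousOn x).sub (hv.continuousOn x), fun x s hs => ?_⟩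
  · linarith [abs_sub (u s x) (v s x), hA s hs x, hB s hs x]
  · have hs' : s ∈ Icc 0 t := Ico_subset_Icc_self hs
    have := hq s hs' x
    rw [gen_sub (integrable_of_abs_le (hu.measurable s hs') (hA s hs'))
      (integrable_of_abs_le (hv.measurable s hs') (hB s hs'))]
    exact ((hu.hasDeriv x s hs).sub (hv.hasDeriv x s hs)).congr_deriv (by ring)

theorem IsBackwardSolution.const (c : ℝ) : IsBackwardSolution q t (fun _ _ => c) :=
  ⟨fun _ _ => measurable_const, ⟨|c|, fun _ _ _ => le_rfl⟩, fun _ => continuousOn_const,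
    fun x s _ => by simpa [gen] using hasDerivWithinAt_const s (Ici s) c⟩

/-- Where V ≥ N the first term alone exceeds B. Where V < N the jump rate is at most C N, and
inserting the bound for k into the integral part of the generator gives the bound for k + 1: the
first term is a supersolution by the Lyapunov inequality, and the second gains one time integration.
-/
theorem IsBackwardSolution.le_of_induction (h : IsLyapunovOn q V W C t)
    (hw : IsBackwardSolution q t w) (h0 : ∀ x, w t x = 0) {B N : ℝ}
    (hB : ∀ s ∈ Icc 0 t, ∀ x, |w s x| ≤ B) (hB0 : 0 ≤ B) (hN : 0 < N) (k : ℕ) :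
    ∀ x, ∀ s ∈ Icc 0 t, w s x ≤ B / N * Real.exp (C * (t - s)) * W x
      + B * ((C * N * (t - s)) ^ k / k.factorial) := by
  have hC := h.pos.le
  have hW : ∀ x, 1 ≤ W x := fun x => (h.one_le x).trans (h.V_le_W x)
  have hexp : ∀ s ∈ Icc 0 t, 1 ≤ Real.exp (C * (t - s)) := fun s hs =>
    Real.one_le_exp (mul_nonneg hC (by linarith [hs.2]))
  induction k with
  | zero =>
    intro x s hs
    have h1 : 0 ≤ B / N * Real.exp (C * (t - s)) * W x := by have := hW x; positivity
    have h2 := (le_abs_self _).trans (hB s hs x)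
    simpa using by linarith
  | succ k ih =>
    intro x s hs
    have hpow : ∀ r ∈ Icc 0 t, 0 ≤ C * N * (t - r) := fun r hr =>
      mul_nonneg (by positivity) (by linarith [hr.2])
    by_cases hx : N ≤ V x
    · have h2 := (le_abs_self _).trans (hB s hs x)
      have h3 : 0 ≤ B * ((C * N * (t - s)) ^ (k + 1) / (k + 1).factorial) := by
        have := hpow s hs; positivity
      have h4 : B ≤ B / N * Real.exp (C * (t - s)) * W x := by
        have h5 : 1 * N ≤ Real.exp (C * (t - s)) * W x :=
          mul_le_mul (hexp s hs) (hx.trans (h.V_le_W x)) hN.le (Real.exp_pos _).le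
        calc B = B / N * (1 * N) := by field_simp
          _ ≤ B / N * (Real.exp (C * (t - s)) * W x) :=
            mul_le_mul_of_nonneg_left h5 (by positivity)
          _ = _ := by ring
      linarith
    · push Not at hx
      set δ := B / N with hδ
      have hδ0 : 0 ≤ δ := by positivity
      have hsub : Icc s t ⊆ Icc 0 t := Icc_subset_Icc_left hs.1
      -- The comparison is carried out in time only, at the fixed point x: g is the claimed bound
      -- minus w.
      set g : ℝ → ℝ := fun r => δ * Real.exp (C * (t - r)) * W x
        + B * ((C * N * (t - r)) ^ (k + 1) / (k + 1).factorial) - w r x with hgdef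
      have hlin : ∀ c r : ℝ, HasDerivAt (fun r => c * (t - r)) (-c) r := fun c r => by
        simpa using ((hasDerivAt_id r).const_sub t).const_mul c
      have hderiv : ∀ r ∈ Ico s t, HasDerivWithinAt g
          (δ * (Real.exp (C * (t - r)) * -C) * W x
            + B * (-(C * N) * ((C * N * (t - r)) ^ k / k.factorial))
            - -gen (q r) (w r) x) (Ici r) r := by
        intro r hr
        refine HasDerivWithinAt.sub (HasDerivAt.hasDerivWithinAt (HasDerivAt.add ?_ ?_))
          (hw.hasDeriv x r ⟨hs.1.trans hr.1, hr.2⟩)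
        · exact (((hlin C r).exp).const_mul δ).mul_const (W x)
        · refine (HasDerivAt.div_const ((hlin (C * N) r).pow (k + 1)) _).const_mul B |>.congr_deriv ?_
          rw [Nat.factorial_succ]
          push_cast
          have : (k.factorial : ℝ) ≠ 0 := by positivity
          have : (k : ℝ) + 1 ≠ 0 := by positivity
          field_simp
      have hcont : ContinuousOn g (Icc s t) := by
        refine ContinuousOn.sub ?_ ((hw.continuousOn x).mono hsub)
        fun_prop
      have hgt : 0 ≤ g t := by
        have := hW x
        simp only [hgdef, h0, sub_self, mul_zero, Real.exp_zero]
        rw [zero_pow (Nat.succ_ne_zero k)]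
        simp only [zero_div, mul_zero, add_zero, sub_zero, mul_one]
        positivity
      have hfin := nonneg_left_of_deriv_right_nonpos hs.2 hcont hderiv ?_ hgt
      · simp only [hgdef] at hfin
        linarith
      · intro r hr hgr
        have hr' : r ∈ Icc 0 t := ⟨hs.1.trans hr.1, hr.2.le⟩
        have := h.finite r hr' x
        have hI := integrable_of_abs_le (μ := q r x) (hw.measurable r hr') (hB r hr')
        set m := (q r x).real univ with hm
        have hm0 : 0 ≤ m := measureReal_nonneg
        have hmN : m ≤ C * N := (h.mass_le r hr' x).trans
          (mul_le_mul_of_nonneg_left hx.le hC)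
        set e := Real.exp (C * (t - r))
        have he : 0 < e := Real.exp_pos _
        set p := (C * N * (t - r)) ^ k / k.factorial
        have hp : 0 ≤ p := by have := hpow r hr'; positivity
        have hint : ∫ y, w r y ∂q r x ≤ δ * e * ((C + m) * W x) + m * (B * p) := by
          calc ∫ y, w r y ∂q r x ≤ ∫ y, (δ * e * W y + B * p) ∂q r x :=
                integral_mono hI (((h.integrable_W r hr' x).const_mul _).add (integrable_const _))
                  fun y => ih y r hr'
            _ = δ * e * ∫ y, W y ∂q r x + m * (B * p) := by
                rw [integral_add ((h.integrable_W r hr' x).const_mul _) (integrable_const _),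
                  integral_const_mul]
                simp [hm]
            _ ≤ _ := by
                have := mul_le_mul_of_nonneg_left (h.integral_W_le hr' x)
                  (mul_nonneg hδ0 he.le)
                linarith
        -- Only here is g r < 0 used: it gives w ≥ δ e W at x, so the loss term -m w absorbs the
        -- gain m δ e W. What remains of the derivative is at most (m - C N) B p ≤ 0.
        have hgr2 : δ * e * W x - w r x ≤ 0 := by
          have : 0 ≤ B * ((C * N * (t - r)) ^ (k + 1) / (k + 1).factorial) := by
            have := hpow r hr'; positivity
          simp only [hgdef] at hgr
          linarith
        rw [gen_eq hI]
        have h1 : m * (B * p) ≤ C * N * (B * p) :=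
          mul_le_mul_of_nonneg_right hmN (by positivity)
        have h2 : m * (δ * e * W x - w r x) ≤ 0 := mul_nonpos_of_nonneg_of_nonpos hm0 hgr2
        linarith

theorem IsBackwardSolution.nonpos (h : IsLyapunovOn q V W C t)
    (hw : IsBackwardSolution q t w) (h0 : ∀ x, w t x = 0) {s : ℝ} (hs : s ∈ Icc 0 t) (x : E) :
    w s x ≤ 0 := by
  obtain ⟨B, hB⟩ := hw.bounded
  have hB0 : 0 ≤ B := (abs_nonneg _).trans (hB s hs x)
  have h1 : ∀ N : ℝ, 0 < N → w s x ≤ B / N * Real.exp (C * (t - s)) * W x := by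
    intro N hN
    have hlim : Tendsto (fun k : ℕ => B / N * Real.exp (C * (t - s)) * W x
        + B * ((C * N * (t - s)) ^ k / k.factorial)) atTop
        (𝓝 (B / N * Real.exp (C * (t - s)) * W x + B * 0)) :=
      ((FloorSemiring.tendsto_pow_div_factorial_atTop _).const_mul B).const_add _
    simpa using ge_of_tendsto' hlim fun k => hw.le_of_induction h h0 hB hB0 hN k x s hs
  have hlim : Tendsto (fun N : ℝ => B / N * Real.exp (C * (t - s)) * W x) atTop
      (𝓝 (0 * Real.exp (C * (t - s)) * W x)) :=
    ((tendsto_const_nhds.div_atTop tendsto_id).mul_const _).mul_const _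
  simpa using ge_of_tendsto hlim ((eventually_gt_atTop 0).mono h1)

/-- Bounded solutions of the backward equation are determined by their terminal value. -/
theorem IsBackwardSolution.unique (h : IsLyapunovOn q V W C t)
    (hu : IsBackwardSolution q t u) (hv : IsBackwardSolution q t v) (h0 : ∀ x, u t x = v t x)
    {s : ℝ} (hs : s ∈ Icc 0 t) (x : E) : u s x = v s x := by
  have h1 := (hu.sub h.finite hv).nonpos h (by simp [h0]) hs x
  have h2 := (hv.sub h.finite hu).nonpos h (by simp [h0]) hs x
  linarith

/-- The generator of a function bounded by B is at most 2 B times the total rate. This Lipschitz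
bound in time later gives the jump conditions and the domination in the forward equation. -/
theorem IsBackwardSolution.abs_sub_le (h : IsLyapunovOn q V W C t) (hu : IsBackwardSolution q t u)
    {B : ℝ} (hB : ∀ s ∈ Icc 0 t, ∀ x, |u s x| ≤ B) {s : ℝ} (hs : s ∈ Icc 0 t) (x : E) :
    |u t x - u s x| ≤ 2 * B * (C * V x) * (t - s) := by
  have hsub : Icc s t ⊆ Icc 0 t := Icc_subset_Icc_left hs.1
  refine norm_image_sub_le_of_norm_deriv_right_le_segment (f := fun r => u r x)
    ((hu.continuousOn x).mono hsub)
    (fun r hr => hu.hasDeriv x r ⟨hs.1.trans hr.1, hr.2⟩) (fun r hr => ?_) t (right_mem_Icc.2 hs.2)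
  have hr' : r ∈ Icc 0 t := hsub (Ico_subset_Icc_self hr)
  have := h.finite r hr' x
  have hB0 : 0 ≤ B := (abs_nonneg _).trans (hB s hs x)
  rw [norm_neg]
  exact (abs_gen_le (hB r hr')).trans
    (mul_le_mul_of_nonneg_left (h.mass_le r hr' x) (by positivity))

end BackwardEquation

/-! ### Construction of the minimal process by summing over the number of jumps -/

section MinimalKernel

variable {E : Type*} [MeasurableSpace E]

/-- Density of the first jump time of a process started at time `p.1` in `p.2`, before time `t`,
for jumps at the exponential rate `c`. -/
def jumpTimeDensity (c : E → ℝ) (t : ℝ) (p : ℝ × E) (r : ℝ) : ℝ :=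
  (Ioc p.1 t).indicator (fun r => c p.2 * Real.exp (-(c p.2 * (r - p.1)))) r

/-- Law of the first jump time before `t`. -/
def jumpTimeKernel (c : E → ℝ) (t : ℝ) : Kernel (ℝ × E) ℝ :=
  (Kernel.const (ℝ × E) (volume : Measure ℝ)).withDensity
    fun p r => ENNReal.ofReal (jumpTimeDensity c t p r)

instance (c : E → ℝ) (t : ℝ) : IsSFiniteKernel (jumpTimeKernel c t) :=
  Kernel.IsSFiniteKernel.withDensity _ fun _ _ => ENNReal.ofReal_ne_top

/-- Law of the first jump (time and target) before `t`. -/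
def jumpKernel (Q : Kernel (ℝ × E) E) (c : E → ℝ) (t : ℝ) : Kernel (ℝ × E) (ℝ × E) :=
  jumpTimeKernel c t ⊗ₖ
    Q.comap (fun a : (ℝ × E) × ℝ => (a.2, a.1.2)) (by fun_prop)

/-- The part of the law at time `t` without jumps. -/
def stayKernel (c : E → ℝ) (t : ℝ) : Kernel (ℝ × E) E :=
  (Kernel.deterministic (Prod.snd : ℝ × E → E) measurable_snd).withDensity
    -- The truncation makes the weight 1 for starting times after t, so it never exceeds 1.
    fun p _ => ENNReal.ofReal (Real.exp (-(c p.2 * max (t - p.1) 0)))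

/-- The part of the law at time `t` with exactly `n` jumps. -/
def jumpCountKernel (Q : Kernel (ℝ × E) E) (c : E → ℝ) (t : ℝ) : ℕ → Kernel (ℝ × E) E
  | 0 => stayKernel c t
  | n + 1 => jumpCountKernel Q c t n ∘ₖ jumpKernel Q c t

/-- The law at time `t` of the minimal jump process with jump rate `c` and jump law `Q`. -/
def minimalKernel (Q : Kernel (ℝ × E) E) (c : E → ℝ) (t : ℝ) : Kernel (ℝ × E) E :=
  Kernel.sum (jumpCountKernel Q c t)

variable {Q : Kernel (ℝ × E) E} {c : E → ℝ} {t : ℝ}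

theorem measurable_jumpTimeDensity (hc : Measurable c) :
    Measurable (Function.uncurry (jumpTimeDensity c t)) := by
  have : Function.uncurry (jumpTimeDensity c t) = {a : (ℝ × E) × ℝ | a.1.1 < a.2 ∧ a.2 ≤ t}.indicator
      fun a => c a.1.2 * Real.exp (-(c a.1.2 * (a.2 - a.1.1))) := by
    ext a; simp [jumpTimeDensity, Function.uncurry, indicator]
  rw [this]
  refine Measurable.indicator (by fun_prop) ?_
  exact (measurableSet_lt measurable_fst.fst measurable_snd).inter
    (measurableSet_le measurable_snd measurable_const)

omit [MeasurableSpace E] in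
theorem jumpTimeDensity_nonneg (hc0 : ∀ x, 0 ≤ c x) (p : ℝ × E) (r : ℝ) :
    0 ≤ jumpTimeDensity c t p r :=
  indicator_nonneg (fun _ _ => mul_nonneg (hc0 _) (Real.exp_pos _).le) _

omit [MeasurableSpace E] in
theorem lintegral_jumpTimeDensity_mul (p : ℝ × E) (g : ℝ → ℝ≥0∞) :
    ∫⁻ r, ENNReal.ofReal (jumpTimeDensity c t p r) * g r
      = ∫⁻ r in Ioc p.1 t, ENNReal.ofReal (c p.2 * Real.exp (-(c p.2 * (r - p.1)))) * g r := by
  rw [← lintegral_indicator measurableSet_Ioc]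
  refine lintegral_congr fun r => ?_
  by_cases h : r ∈ Ioc p.1 t <;> simp [jumpTimeDensity, h]

theorem lintegral_jumpKernel [IsSFiniteKernel Q] (hc : Measurable c) (p : ℝ × E)
    {f : ℝ × E → ℝ≥0∞} (hf : Measurable f) :
    ∫⁻ a, f a ∂jumpKernel Q c t p = ∫⁻ r in Ioc p.1 t,
      ENNReal.ofReal (c p.2 * Real.exp (-(c p.2 * (r - p.1)))) * ∫⁻ y, f (r, y) ∂Q (r, p.2) := by
  have hd := (measurable_jumpTimeDensity (t := t) hc).ennreal_ofReal
  rw [jumpKernel, Kernel.lintegral_compProd _ _ _ hf, jumpTimeKernel, Kernel.lintegral_withDensity _ hd,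
    Kernel.const_apply, lintegral_jumpTimeDensity_mul]
  · rfl
  · exact Measurable.lintegral_kernel_prod_right'' (a := p)
      (η := Q.comap (fun a : (ℝ × E) × ℝ => (a.2, a.1.2)) (by fun_prop)) hf

theorem lintegral_stayKernel (hc : Measurable c) (p : ℝ × E) {f : E → ℝ≥0∞} (hf : Measurable f) :
    ∫⁻ y, f y ∂stayKernel c t p
      = ENNReal.ofReal (Real.exp (-(c p.2 * max (t - p.1) 0))) * f p.2 := by
  rw [stayKernel, Kernel.lintegral_withDensity _ _ _ hf, Kernel.deterministic_apply,
    lintegral_dirac' _ (by fun_prop)]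
  simp only [Function.uncurry_def]
  fun_prop

theorem minimalKernel_comp_jumpKernel : minimalKernel Q c t ∘ₖ jumpKernel Q c t
    = Kernel.sum fun n => jumpCountKernel Q c t (n + 1) := by
  simp only [minimalKernel, Kernel.comp_sum_left, jumpCountKernel]

theorem minimalKernel_eq :
    minimalKernel Q c t = stayKernel c t + minimalKernel Q c t ∘ₖ jumpKernel Q c t := by
  refine Kernel.ext fun p => Measure.ext fun s hs => ?_
  rw [minimalKernel_comp_jumpKernel, _root_.add_apply, Measure.add_apply, minimalKernel,
    Kernel.sum_apply' _ _ hs, Kernel.sum_apply' _ _ hs]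
  exact tsum_eq_zero_add' (f := fun n => jumpCountKernel Q c t n p s) ENNReal.summable

/-- If `φ ≥ 0` satisfies `c Q φ ≤ (C + c) φ`, then its integral grows at most like `exp (C s)`. -/
theorem lintegral_minimalKernel_le [IsSFiniteKernel Q] (hc : Measurable c) (hc0 : ∀ x, 0 ≤ c x)
    {C : ℝ} (hC : 0 ≤ C) {φ : E → ℝ≥0∞} (hφ : Measurable φ) {s₀ : ℝ}
    (hQ : ∀ r ∈ Icc s₀ t, ∀ x,
      ENNReal.ofReal (c x) * ∫⁻ y, φ y ∂Q (r, x) ≤ ENNReal.ofReal (C + c x) * φ x)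
    {s : ℝ} (hs : s₀ ≤ s) (x : E) :
    ∫⁻ y, φ y ∂minimalKernel Q c t (s, x)
      ≤ ENNReal.ofReal (Real.exp (C * max (t - s) 0)) * φ x := by
  have hmeas : ∀ n, Measurable fun p => ∫⁻ y, φ y ∂jumpCountKernel Q c t n p :=
    fun n => hφ.lintegral_kernel
  -- Partial sums over the number of jumps obey the same bound; the induction splits off the path
  -- without jumps and conditions the others on their first jump.
  have hpart : ∀ n, ∀ x, ∀ s, s₀ ≤ s →
      ∑ i ∈ Finset.range n, ∫⁻ y, φ y ∂jumpCountKernel Q c t i (s, x)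
        ≤ ENNReal.ofReal (Real.exp (C * max (t - s) 0)) * φ x := by
    intro n
    induction n with
    | zero => simp
    | succ n ih =>
      intro x s hs
      rw [Finset.sum_range_succ']
      have h1 : ∑ i ∈ Finset.range n, ∫⁻ y, φ y ∂jumpCountKernel Q c t (i + 1) (s, x)
          = ∫⁻ a, ∑ i ∈ Finset.range n, ∫⁻ y, φ y ∂jumpCountKernel Q c t i a
            ∂jumpKernel Q c t (s, x) := by
        rw [lintegral_finsetSum _ fun i _ => hmeas i]
        refine Finset.sum_congr rfl fun i _ => ?_
        rw [jumpCountKernel, Kernel.lintegral_comp _ _ _ hφ]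
      rw [h1, lintegral_jumpKernel hc _ (Finset.measurable_sum _ fun i _ => hmeas i)]
      simp only [jumpCountKernel]
      rw [lintegral_stayKernel hc _ hφ]
      simp only
      have h2 : ∫⁻ r in Ioc s t, ENNReal.ofReal (c x * Real.exp (-(c x * (r - s)))) *
            ∫⁻ y, ∑ i ∈ Finset.range n, ∫⁻ z, φ z ∂jumpCountKernel Q c t i (r, y) ∂Q (r, x)
          ≤ ∫⁻ r in Ioc s t, ENNReal.ofReal ((C + c x) * Real.exp (-(c x * (r - s)))
              * Real.exp (C * (t - r))) * φ x := by
        refine setLIntegral_mono' measurableSet_Ioc fun r hr => ?_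
        have hr0 : s₀ ≤ r := hs.trans hr.1.le
        have e1 : ∫⁻ y, ∑ i ∈ Finset.range n, ∫⁻ z, φ z ∂jumpCountKernel Q c t i (r, y) ∂Q (r, x)
            ≤ ENNReal.ofReal (Real.exp (C * (t - r))) * ∫⁻ y, φ y ∂Q (r, x) := by
          rw [← lintegral_const_mul _ hφ]
          refine lintegral_mono fun y => (ih y r hr0).trans_eq ?_
          rw [max_eq_left (by linarith [hr.2])]
        have h0 := hc0 x
        rw [ENNReal.ofReal_mul (hc0 x), ENNReal.ofReal_mul (by positivity),
          ENNReal.ofReal_mul (by positivity)]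
        calc _ ≤ _ := mul_le_mul_right e1 _
          _ = ENNReal.ofReal (Real.exp (-(c x * (r - s)))) * ENNReal.ofReal (Real.exp (C * (t - r)))
              * (ENNReal.ofReal (c x) * ∫⁻ y, φ y ∂Q (r, x)) := by ring
          _ ≤ _ := mul_le_mul_right (hQ r ⟨hr0, hr.2⟩ x) _
          _ = _ := by ring
      refine (add_le_add_left h2 _).trans ?_
      rw [lintegral_mul_const _ (by fun_prop), ← add_mul]
      refine mul_le_mul_left ?_ _
      rcases le_total t s with hts | hst
      · simp [Ioc_eq_empty_of_le hts, max_eq_right (sub_nonpos.2 hts)]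
      · have hx0 := hc0 x
        rw [← ofReal_integral_eq_lintegral_ofReal, ← ENNReal.ofReal_add,
          ← intervalIntegral.integral_of_le hst, max_eq_left (by linarith)]
        · refine ENNReal.ofReal_le_ofReal (le_of_eq ?_)
          -- The bound reproduces itself exactly: the integral of (C + c) exp(-c(r-s)) exp(C(t-r))
          -- over [s, t] is exp(C(t-s)) - exp(-c(t-s)), and the subtracted term is the weight of not
          -- jumping.
          have hder : ∀ r : ℝ, HasDerivAt
              (fun r => -(Real.exp (-(c x * (r - s))) * Real.exp (C * (t - r))))
              ((C + c x) * Real.exp (-(c x * (r - s))) * Real.exp (C * (t - r))) r := by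
            intro r
            have d1 : HasDerivAt (fun r => -(c x * (r - s))) (-(c x * 1)) r :=
              (((hasDerivAt_id r).sub_const s).const_mul (c x)).neg
            have d2 : HasDerivAt (fun r => C * (t - r)) (C * (-1)) r :=
              ((hasDerivAt_id r).const_sub t).const_mul C
            exact (d1.exp.mul d2.exp).neg.congr_deriv (by ring)
          rw [intervalIntegral.integral_eq_sub_of_hasDerivAt (fun r _ => hder r)
            (Continuous.intervalIntegrable (by fun_prop) _ _)]
          simp
        · exact integral_nonneg fun r => by positivity
        · positivity
        · exact (Continuous.integrableOn_Ioc (by fun_prop))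
        · exact ae_of_all _ fun r => by positivity
  rw [minimalKernel, Kernel.sum_apply, lintegral_sum_measure]
  exact ENNReal.tsum_le_of_sum_range_le fun n => hpart n x s hs

end MinimalKernel

/-! ### First-jump integral equation for the minimal kernel -/

section MinimalKernelEquation

variable {E : Type*} [MeasurableSpace E] {Q : Kernel (ℝ × E) E} [IsMarkovKernel Q] {c : E → ℝ}
  {t : ℝ}

/-- The growth bound with φ = 1 and C = 0 gives mass at most 1. That no mass is lost is obtained
later, from uniqueness. -/
theorem isFiniteKernel_minimalKernel (hc : Measurable c) (hc0 : ∀ x, 0 ≤ c x) :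
    IsFiniteKernel (minimalKernel Q c t) := by
  refine ⟨1, ENNReal.one_lt_top, fun p => ?_⟩
  have := lintegral_minimalKernel_le (Q := Q) (t := t) hc hc0 le_rfl (φ := fun _ => 1)
    measurable_const (s₀ := p.1) (by simp) le_rfl p.2
  simpa using this

theorem measureReal_minimalKernel_le_one (hc : Measurable c) (hc0 : ∀ x, 0 ≤ c x) (p : ℝ × E) :
    (minimalKernel Q c t p).real univ ≤ 1 := by
  have := lintegral_minimalKernel_le (Q := Q) (t := t) hc hc0 le_rfl (φ := fun _ => 1)
    measurable_const (s₀ := p.1) (by simp) le_rfl p.2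
  exact ENNReal.toReal_le_of_le_ofReal zero_le_one (by simpa using this)

theorem abs_integral_minimalKernel_le (hc : Measurable c) (hc0 : ∀ x, 0 ≤ c x) {f : E → ℝ} {B : ℝ}
    (hB0 : 0 ≤ B) (hB : ∀ x, |f x| ≤ B) (p : ℝ × E) :
    |∫ y, f y ∂minimalKernel Q c t p| ≤ B := by
  have := isFiniteKernel_minimalKernel (Q := Q) (t := t) hc hc0
  refine (norm_integral_le_of_norm_le_const (f := f) (ae_of_all _ hB)).trans ?_
  exact mul_le_of_le_one_right hB0 (measureReal_minimalKernel_le_one hc hc0 p)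

omit [IsMarkovKernel Q] in
theorem measurable_integral_minimalKernel {f : E → ℝ} (hf : Measurable f) :
    Measurable fun p => ∫ y, f y ∂minimalKernel Q c t p :=
  (StronglyMeasurable.integral_kernel hf.stronglyMeasurable).measurable

/-- First-jump decomposition of the minimal kernel. -/
theorem integral_minimalKernel (hc : Measurable c) (hc0 : ∀ x, 0 ≤ c x) {f : E → ℝ}
    (hf : Measurable f) {B : ℝ} (hB : ∀ x, |f x| ≤ B) {s : ℝ} (hs : s ≤ t) (x : E) :
    ∫ y, f y ∂minimalKernel Q c t (s, x) = Real.exp (-(c x * (t - s))) * f x +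
      ∫ r in s..t, c x * Real.exp (-(c x * (r - s))) *
        ∫ y, (∫ z, f z ∂minimalKernel Q c t (r, y)) ∂Q (r, x) := by
  have hfin := isFiniteKernel_minimalKernel (Q := Q) (t := t) hc hc0
  have heq : minimalKernel Q c t (s, x) = stayKernel c t (s, x)
      + (minimalKernel Q c t ∘ₖ jumpKernel Q c t) (s, x) := by
    conv_lhs => rw [minimalKernel_eq]
    rfl
  have hf1 : IsFiniteMeasure (stayKernel c t (s, x)) :=
    isFiniteMeasure_of_le (minimalKernel Q c t (s, x)) (heq ▸ Measure.le_add_right le_rfl)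
  have hf2 : IsFiniteMeasure ((minimalKernel Q c t ∘ₖ jumpKernel Q c t) (s, x)) :=
    isFiniteMeasure_of_le (minimalKernel Q c t (s, x)) (heq ▸ Measure.le_add_left le_rfl)
  have hI2 := integrable_of_abs_le (μ := (minimalKernel Q c t ∘ₖ jumpKernel Q c t) (s, x)) hf hB
  rw [heq, integral_add_measure (integrable_of_abs_le hf hB) hI2]
  congr 1
  · have hm : Measurable (Function.uncurry fun (p : ℝ × E) (_ : E) =>
        ENNReal.ofReal (Real.exp (-(c p.2 * max (t - p.1) 0)))) := by
      simp only [Function.uncurry_def]; fun_prop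
    rw [stayKernel, Kernel.withDensity_apply _ hm, integral_withDensity_eq_integral_toReal_smul
      (by fun_prop) (ae_of_all _ fun _ => ENNReal.ofReal_lt_top), Kernel.deterministic_apply,
      integral_dirac' _ _ (by fun_prop)]
    simp [max_eq_left (sub_nonneg.2 hs), Real.exp_nonneg]
  · have hd := (measurable_jumpTimeDensity (t := t) hc).ennreal_ofReal
    have hd' : Measurable fun r => ENNReal.ofReal (jumpTimeDensity c t (s, x) r) :=
      hd.comp measurable_prodMk_left
    rw [Kernel.integral_comp hI2, jumpKernel, ProbabilityTheory.integral_compProd hI2.integral_comp,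
      jumpTimeKernel, Kernel.withDensity_apply _ hd, integral_withDensity_eq_integral_toReal_smul
      hd' (ae_of_all _ fun _ => ENNReal.ofReal_lt_top), Kernel.const_apply,
      intervalIntegral.integral_of_le hs, ← integral_indicator measurableSet_Ioc]
    refine integral_congr_ae (ae_of_all _ fun r => ?_)
    simp only [ENNReal.toReal_ofReal (jumpTimeDensity_nonneg hc0 _ _), smul_eq_mul]
    by_cases hr : r ∈ Ioc s t
    · simp [jumpTimeDensity, hr, Kernel.comap_apply]
    · simp [jumpTimeDensity, hr]

theorem continuousOn_integral_minimalKernel (hc : Measurable c) (hc0 : ∀ x, 0 ≤ c x) {f : E → ℝ}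
    (hf : Measurable f) {B : ℝ} (hB : ∀ x, |f x| ≤ B) (x : E) :
    ContinuousOn (fun s => ∫ y, f y ∂minimalKernel Q c t (s, x)) (Iic t) := by
  have hB0 : 0 ≤ B := (abs_nonneg _).trans (hB x)
  set h : ℝ → ℝ := fun r => ∫ y, (∫ z, f z ∂minimalKernel Q c t (r, y)) ∂Q (r, x) with hh
  have hmeas : StronglyMeasurable h := by
    have h1 : StronglyMeasurable fun p : ℝ × E =>
        ∫ y, (∫ z, f z ∂minimalKernel Q c t (p.1, y)) ∂Q p :=
      StronglyMeasurable.integral_kernel_prod_right'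
        (f := fun a : (ℝ × E) × E => ∫ z, f z ∂minimalKernel Q c t (a.1.1, a.2))
        ((measurable_integral_minimalKernel hf).comp
          (measurable_fst.fst.prodMk measurable_snd)).stronglyMeasurable
    exact h1.comp_measurable (measurable_id.prodMk measurable_const)
  have hbd : ∀ r, |h r| ≤ B := fun r => by
    refine (norm_integral_le_of_norm_le_const (f := fun y => ∫ z, f z ∂minimalKernel Q c t (r, y))
      (ae_of_all _ fun y => abs_integral_minimalKernel_le hc hc0 hB0 hB _)).trans ?_
    simp
  have hint : ∀ a b : ℝ, IntervalIntegrable (fun r => Real.exp (-(c x * r)) * h r) volume a b := by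
    intro a b
    have h1 : IntervalIntegrable h volume a b :=
      (intervalIntegrable_const (c := B)).mono_fun' hmeas.aestronglyMeasurable (ae_of_all _ hbd)
    exact h1.continuousOn_mul (by fun_prop)
  -- Factoring out exp(c s) leaves an integrand independent of s, so s enters the integral only as a
  -- limit of integration.
  have hcont : Continuous fun s => Real.exp (-(c x * (t - s))) * f x
      + c x * Real.exp (c x * s) * ∫ r in s..t, Real.exp (-(c x * r)) * h r := by
    have h1 : Continuous fun s => ∫ r in s..t, Real.exp (-(c x * r)) * h r := by
      simp_rw [fun s => intervalIntegral.integral_symm (f := fun r => Real.exp (-(c x * r)) * h r)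
        (μ := volume) t s]
      exact (intervalIntegral.continuous_primitive hint t).neg
    fun_prop
  refine hcont.continuousOn.congr fun s hs => ?_
  beta_reduce
  rw [integral_minimalKernel hc hc0 hf hB hs x, ← intervalIntegral.integral_const_mul]
  congr 1
  refine intervalIntegral.integral_congr fun r _ => ?_
  rw [show -(c x * (r - s)) = c x * s + -(c x * r) by ring, Real.exp_add]
  simp only [hh]
  ring

end MinimalKernelEquation

/-! ### Continuity in time of the rates, and the uniformized jump law -/

section TimeDependentRates

variable {E : Type*} [MeasurableSpace E] {q : ℝ → Kernel E E} {V W : E → ℝ} {C T t : ℝ}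

theorem IsTVContinuousOn.exists_abs_sub_le (h : IsTVContinuousOn q T) (x : E) (B : ℝ) {δ : ℝ}
    (hδ : 0 < δ) : ∃ η > 0, ∀ s ∈ Icc 0 T, ∀ t ∈ Icc 0 T, |t - s| ≤ η → ∀ f : E → ℝ,
      Measurable f → (∀ y, |f y| ≤ B) → |(∫ y, f y ∂q t x) - ∫ y, f y ∂q s x| ≤ δ := by
  set A := |B| + 1 with hA
  have hA0 : 0 < A := by positivity
  obtain ⟨η, hη, H⟩ := h x (δ / A) (by positivity)
  refine ⟨η, hη, fun s hs t ht hst f hf hB => ?_⟩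
  have h1 := H s hs t ht hst (fun y => f y / A) (hf.div_const A) fun y => by
    rw [abs_div, abs_of_pos hA0, div_le_one hA0]
    linarith [hB y, le_abs_self B]
  simp only [integral_div] at h1
  rwa [← sub_div, abs_div, abs_of_pos hA0, div_le_div_iff_of_pos_right hA0] at h1

theorem IsTVContinuousOn.mono (h : IsTVContinuousOn q T) (ht : t ≤ T) : IsTVContinuousOn q t := by
  intro x δ hδ
  obtain ⟨η, hη, H⟩ := h x δ hδ
  exact ⟨η, hη, fun s hs r hr => H s (Icc_subset_Icc_right ht hs) r (Icc_subset_Icc_right ht hr)⟩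

/-- Split q_r u_r - q_s u_s into (q_r - q_s) u_r, small by total variation uniformly over functions
bounded by B, and q_s (u_r - u_s), which tends to 0 by dominated convergence. -/
theorem IsTVContinuousOn.continuousOn_integral (hq : ∀ s ∈ Icc 0 T, ∀ x, IsFiniteMeasure (q s x))
    (h : IsTVContinuousOn q T) {u : ℝ → E → ℝ} (hu : ∀ s ∈ Icc 0 T, Measurable (u s)) {B : ℝ}
    (hB : ∀ s ∈ Icc 0 T, ∀ y, |u s y| ≤ B) (hcont : ∀ y, ContinuousOn (fun s => u s y) (Icc 0 T))
    (x : E) : ContinuousOn (fun s => ∫ y, u s y ∂q s x) (Icc 0 T) := by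
  intro s hs
  have := hq s hs x
  have h1 : Tendsto (fun r => ∫ y, u r y ∂q s x) (𝓝[Icc 0 T] s) (𝓝 (∫ y, u s y ∂q s x)) := by
    refine tendsto_integral_filter_of_dominated_convergence (fun _ => B) ?_ ?_
      (integrable_const _) (ae_of_all _ fun y => hcont y s hs)
    · filter_upwards [self_mem_nhdsWithin] with r hr using (hu r hr).aestronglyMeasurable
    · filter_upwards [self_mem_nhdsWithin] with r hr using ae_of_all _ (hB r hr)
  have h2 : Tendsto (fun r => (∫ y, u r y ∂q r x) - ∫ y, u r y ∂q s x) (𝓝[Icc 0 T] s) (𝓝 0) := by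
    rw [Metric.tendsto_nhds]
    intro δ hδ
    obtain ⟨η, hη, H⟩ := h.exists_abs_sub_le x B (half_pos hδ)
    filter_upwards [self_mem_nhdsWithin, mem_nhdsWithin_of_mem_nhds (Metric.closedBall_mem_nhds s hη)]
      with r hr hrs
    rw [dist_zero_right]
    exact (H s hs r hr hrs (u r) (hu r hr) (hB r hr)).trans_lt (half_lt_self hδ)
  have h3 := h2.add h1
  simp only [sub_add_cancel, zero_add] at h3
  exact h3

/-- The embedded jump law `q t x / c x + (1 - q t x univ / c x) δₓ`, with `c = C * V`. -/
theorem IsLyapunovOn.exists_jumpLaw (h : IsLyapunovOn q V W C T) (hT : 0 ≤ T)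
    (hq : IsTVContinuousOn q T) : ∃ Q : Kernel (ℝ × E) E, IsMarkovKernel Q ∧
      ∀ r ∈ Icc 0 T, ∀ x, Q (r, x) = (ENNReal.ofReal (C * V x))⁻¹ • q r x
        + (1 - (ENNReal.ofReal (C * V x))⁻¹ * q r x univ) • Measure.dirac x := by
  -- Times are clamped to [0, T], so that the jump law is a kernel on all of ℝ × E.
  set cl : ℝ → ℝ := fun r => projIcc 0 T hT r with hcl
  have hclm : ∀ r, cl r ∈ Icc 0 T := fun r => (projIcc 0 T hT r).2
  have hclc : Continuous cl := continuous_subtype_val.comp continuous_projIcc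
  have hmeas : ∀ A, MeasurableSet A → Measurable fun p : ℝ × E => q (cl p.1) p.2 A := by
    intro A hA
    have h1 : Measurable (Function.uncurry fun r x => (q (cl r) x).real A) := by
      -- Joint measurability in (r, x) is not assumed; it follows from continuity in r and
      -- measurability in x.
      refine measurable_uncurry_of_continuous_of_measurable (fun x => ?_) fun r =>
        ((q (cl r)).measurable_coe hA).ennreal_toReal
      have h2 : ContinuousOn (fun r => ∫ y, A.indicator 1 y ∂q r x) (Icc 0 T) :=
        hq.continuousOn_integral h.finite (u := fun _ => A.indicator 1)
          (fun _ _ => measurable_one.indicator hA) (B := 1)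
          (fun _ _ y => by by_cases hy : y ∈ A <;> simp [hy]) (fun _ => continuousOn_const) x
      simp only [integral_indicator_one hA] at h2
      exact h2.comp_continuous hclc hclm
    convert h1.ennreal_ofReal using 2 with p
    have := h.finite _ (hclm p.1) p.2
    simp [Function.uncurry]
  have hV := h.measurable_V
  have hpos : ∀ x, 0 < C * V x := fun x => mul_pos h.pos (by linarith [h.one_le x])
  refine ⟨⟨fun p => (ENNReal.ofReal (C * V p.2))⁻¹ • q (cl p.1) p.2
    + (1 - (ENNReal.ofReal (C * V p.2))⁻¹ * q (cl p.1) p.2 univ) • Measure.dirac p.2, ?_⟩, ⟨?_⟩, ?_⟩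
  · refine Measure.measurable_of_measurable_coe _ fun A hA => ?_
    simp only [Measure.add_apply, Measure.smul_apply, smul_eq_mul, Measure.dirac_apply' _ hA]
    have h1 := hmeas A hA
    have h2 := hmeas univ MeasurableSet.univ
    have h3 : Measurable fun p : ℝ × E => A.indicator (1 : E → ℝ≥0∞) p.2 :=
      (measurable_one.indicator hA).comp measurable_snd
    have h4 : Measurable fun p : ℝ × E => (ENNReal.ofReal (C * V p.2))⁻¹ := by fun_prop
    exact (h4.mul h1).add ((measurable_const.sub (h4.mul h2)).mul h3)
  · intro p
    refine ⟨?_⟩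
    have := h.finite _ (hclm p.1) p.2
    have h1 : q (cl p.1) p.2 univ ≤ ENNReal.ofReal (C * V p.2) := by
      rw [← ofReal_measureReal]
      exact ENNReal.ofReal_le_ofReal (h.mass_le _ (hclm p.1) p.2)
    have h2 : (ENNReal.ofReal (C * V p.2))⁻¹ * q (cl p.1) p.2 univ ≤ 1 := by
      rw [mul_comm, ← div_eq_mul_inv]
      exact ENNReal.div_le_of_le_mul (by simpa using h1)
    simpa using add_tsub_cancel_of_le h2
  · intro r hr x
    simp [hcl, projIcc_of_mem hT hr]

/-- `Q` is the jump law of a process with rates `q` after uniformization by `c`. -/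
def IsJumpLaw (q : ℝ → Kernel E E) (Q : Kernel (ℝ × E) E) (c : E → ℝ) (T : ℝ) : Prop :=
  ∀ r ∈ Icc 0 T, ∀ x, ∀ f : E → ℝ, Measurable f → Integrable f (q r x) →
    Integrable f (Q (r, x)) ∧ c x * ∫ y, f y ∂Q (r, x) = gen (q r) f x + c x * f x

theorem IsLyapunovOn.exists_isJumpLaw (h : IsLyapunovOn q V W C T) (hT : 0 ≤ T)
    (hq : IsTVContinuousOn q T) : ∃ Q : Kernel (ℝ × E) E, IsMarkovKernel Q ∧
      IsJumpLaw q Q (fun x => C * V x) T := by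
  obtain ⟨Q, hQ, hQeq⟩ := h.exists_jumpLaw hT hq
  refine ⟨Q, hQ, fun r hr x f hf hfi => ?_⟩
  have hpos : 0 < C * V x := mul_pos h.pos (by linarith [h.one_le x])
  have := h.finite r hr x
  have hle : (ENNReal.ofReal (C * V x))⁻¹ * q r x univ ≤ 1 := by
    rw [mul_comm, ← div_eq_mul_inv]
    refine ENNReal.div_le_of_le_mul ?_
    rw [one_mul, ← ofReal_measureReal]
    exact ENNReal.ofReal_le_ofReal (h.mass_le r hr x)
  have hinv : (ENNReal.ofReal (C * V x))⁻¹ ≠ ∞ := by simpa using hpos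
  have hd : Integrable f (Measure.dirac x) :=
    integrable_dirac' hf.stronglyMeasurable (by simp [enorm])
  have hd2 : 1 - (ENNReal.ofReal (C * V x))⁻¹ * q r x univ ≠ ∞ :=
    (tsub_le_self.trans_lt ENNReal.one_lt_top).ne
  rw [hQeq r hr x, integral_add_measure (hfi.smul_measure hinv) (hd.smul_measure hd2),
    integral_smul_measure, integral_smul_measure, integral_dirac' _ _ hf.stronglyMeasurable,
    ENNReal.toReal_sub_of_le hle ENNReal.one_ne_top, ENNReal.toReal_mul, ENNReal.toReal_inv,
    ENNReal.toReal_ofReal hpos.le, gen_eq hfi, ← measureReal_def]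
  refine ⟨(hfi.smul_measure hinv).add_measure (hd.smul_measure hd2), ?_⟩
  simp only [smul_eq_mul, ENNReal.toReal_one]
  generalize C * V x = c at hpos
  field_simp
  ring

end TimeDependentRates

/-! ### Transition kernels to a fixed terminal time -/

section TransitionKernel

variable {E : Type*} [MeasurableSpace E] {q : ℝ → Kernel E E} {V W : E → ℝ} {C T t : ℝ}

/-- The first-jump equation reads u_s = exp(c s) (exp(-c t) f + ∫ exp(-c r) H(r) dr) over [s, t],
with H(r) = c Q u_r = L_r u_r + c u_r. As H is continuous, differentiation gives c u_s - H(s) = -L_s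
u_s. -/
theorem IsLyapunovOn.isBackwardSolution_minimalKernel (h : IsLyapunovOn q V W C t) (ht : 0 ≤ t)
    (hq : IsTVContinuousOn q t) {Q : Kernel (ℝ × E) E} [IsMarkovKernel Q]
    (hQ : IsJumpLaw q Q (fun x => C * V x) t) {f : E → ℝ} (hf : BoundedMeasurable f) :
    IsBackwardSolution q t
      fun s x => ∫ y, f y ∂minimalKernel Q (fun x => C * V x) t (s, x) := by
  obtain ⟨hf, B, hB⟩ := hf
  set c : E → ℝ := fun x => C * V x with hcdef
  have hc : Measurable c := h.measurable_V.const_mul C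
  have hc0 : ∀ x, 0 ≤ c x := fun x => (mul_pos h.pos (by linarith [h.one_le x])).le
  set u : ℝ → E → ℝ := fun s x => ∫ y, f y ∂minimalKernel Q c t (s, x) with hu
  have hBu : ∀ s x, |u s x| ≤ B := fun s x =>
    abs_integral_minimalKernel_le hc hc0 ((abs_nonneg _).trans (hB x)) hB _
  have hmeas : ∀ s, Measurable (u s) := fun s =>
    (measurable_integral_minimalKernel hf).comp measurable_prodMk_left
  have hcont : ∀ x, ContinuousOn (fun s => u s x) (Icc 0 t) := fun x =>
    (continuousOn_integral_minimalKernel hc hc0 hf hB x).mono Icc_subset_Iic_self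
  refine ⟨fun s _ => hmeas s, ⟨B, fun s _ => hBu s⟩, hcont, fun x s hs => ?_⟩
  set H : ℝ → ℝ := fun r => gen (q r) (u r) x + c x * u r x with hH
  have hHc : ContinuousOn H (Icc 0 t) := by
    have h1 := hq.continuousOn_integral h.finite (fun s _ => hmeas s) (fun s _ => hBu s) hcont x
    have h2 := hq.continuousOn_integral h.finite (u := fun _ _ => 1) (B := 1)
      (fun _ _ => measurable_const) (by simp) (fun _ => continuousOn_const) x
    refine ((h1.sub (h2.mul (hcont x))).add ((hcont x).const_mul (c x))).congr fun r hr => ?_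
    have := h.finite r hr x
    simp only [hH, gen_eq (integrable_of_abs_le (μ := q r x) (hmeas r) (hBu r))]
    simp
  -- Extending H continuously to ℝ makes the integral differentiable at the endpoint s = 0 as well.
  set H' : ℝ → ℝ := fun r => H (projIcc 0 t ht r) with hH'
  have hH'c : Continuous H' :=
    hHc.comp_continuous (continuous_subtype_val.comp continuous_projIcc) fun r => Subtype.prop _
  have hHH' : ∀ r ∈ Icc 0 t, H' r = H r := fun r hr => by simp [hH', projIcc_of_mem ht hr]
  set G : ℝ → ℝ := fun s => Real.exp (c x * s) * (Real.exp (-(c x * t)) * f x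
    + ∫ r in s..t, Real.exp (-(c x * r)) * H' r) with hG
  have hGu : ∀ s ∈ Icc 0 t, u s x = G s := by
    intro s hs
    simp only [hu, hG]
    rw [integral_minimalKernel hc hc0 hf hB hs.2, mul_add, ← mul_assoc, ← Real.exp_add,
      ← intervalIntegral.integral_const_mul]
    congr 1
    · ring_nf
    · refine intervalIntegral.integral_congr fun r hr => ?_
      rw [uIcc_of_le hs.2] at hr
      have hr' : r ∈ Icc 0 t := ⟨hs.1.trans hr.1, hr.2⟩
      have := h.finite r hr' x
      have h1 := (hQ r hr' x (u r) (hmeas r) (integrable_of_abs_le (hmeas r) (hBu r))).2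
      rw [← mul_assoc, ← Real.exp_add, hHH' r hr', hH]
      beta_reduce
      rw [← h1, show -(c x * (r - s)) = c x * s + -(c x * r) by ring]
      ring
  have hs' : s ∈ Icc 0 t := Ico_subset_Icc_self hs
  have hI : Continuous fun r => Real.exp (-(c x * r)) * H' r := by fun_prop
  have hd : HasDerivAt G (-gen (q s) (u s) x) s := by
    have h1 : HasDerivAt (fun s => ∫ r in s..t, Real.exp (-(c x * r)) * H' r)
        (-(Real.exp (-(c x * s)) * H' s)) s :=
      intervalIntegral.integral_hasDerivAt_left (hI.intervalIntegrable _ _)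
        (hI.stronglyMeasurableAtFilter _ _) hI.continuousAt
    have h2 : HasDerivAt (fun s => Real.exp (c x * s)) (Real.exp (c x * s) * (c x * 1)) s :=
      ((hasDerivAt_id s).const_mul (c x)).exp
    refine (h2.mul (h1.const_add (Real.exp (-(c x * t)) * f x))).congr_deriv ?_
    have h3 := hGu s hs'
    simp only [hG] at h3
    have h4 : Real.exp (c x * s) * Real.exp (-(c x * s)) = 1 := by rw [← Real.exp_add]; simp
    have h5 : H s = gen (q s) (u s) x + c x * u s x := rfl
    rw [hHH' s hs', mul_one, mul_right_comm, ← h3]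
    linear_combination (-H s) * h4 - h5
  refine hd.hasDerivWithinAt.congr_of_eventuallyEq ?_ (hGu s hs')
  filter_upwards [Ico_mem_nhdsGE hs.2] with r hr using hGu r ⟨hs.1.trans hr.1, hr.2.le⟩

/-- For the uniformized law, L_r W ≤ C W becomes c Q W ≤ (C + c) W, which is what the growth bound
requires. -/
theorem IsLyapunovOn.lintegral_minimalKernel_W_le (h : IsLyapunovOn q V W C t)
    {Q : Kernel (ℝ × E) E} [IsMarkovKernel Q] (hQ : IsJumpLaw q Q (fun x => C * V x) t)
    {s : ℝ} (hs : s ∈ Icc 0 t) (x : E) :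
    ∫⁻ y, ENNReal.ofReal (W y) ∂minimalKernel Q (fun x => C * V x) t (s, x)
      ≤ ENNReal.ofReal (Real.exp (C * max (t - s) 0)) * ENNReal.ofReal (W x) := by
  have hW : ∀ x, 0 ≤ W x := fun x => by linarith [h.one_le x, h.V_le_W x]
  have hc0 : ∀ x, 0 ≤ C * V x := fun x => (mul_pos h.pos (by linarith [h.one_le x])).le
  refine lintegral_minimalKernel_le (h.measurable_V.const_mul C) hc0 h.pos.le
    h.measurable_W.ennreal_ofReal (s₀ := 0) (fun r hr x => ?_) hs.1 x
  obtain ⟨h1, h2⟩ := hQ r hr x W h.measurable_W (h.integrable_W r hr x)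
  rw [← ofReal_integral_eq_lintegral_ofReal h1 (ae_of_all _ hW), ← ENNReal.ofReal_mul (hc0 x), h2,
    ← ENNReal.ofReal_mul (add_nonneg h.pos.le (hc0 x)), add_mul]
  exact ENNReal.ofReal_le_ofReal (by linarith [h.gen_le r hr x])

/-- Transition kernels to a fixed time `t` solving the backward equation. -/
theorem IsLyapunovOn.exists_transitionKernel (h : IsLyapunovOn q V W C t) (ht : 0 ≤ t)
    (hq : IsTVContinuousOn q t) : ∃ P : ℝ → Kernel E E,
      (∀ s ∈ Icc 0 t, IsMarkovKernel (P s)) ∧ P t = Kernel.id ∧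
      (∀ s ∈ Icc 0 t, ∀ x, Integrable V (P s x)) ∧
      ∀ f, BoundedMeasurable f → IsBackwardSolution q t fun s => act (P s) f := by
  obtain ⟨Q, hQm, hQ⟩ := h.exists_isJumpLaw ht hq
  have hc : Measurable fun x => C * V x := h.measurable_V.const_mul C
  have hc0 : ∀ x, 0 ≤ C * V x := fun x => (mul_pos h.pos (by linarith [h.one_le x])).le
  have hsol := fun f hf => h.isBackwardSolution_minimalKernel ht hq hQ (f := f) hf
  have hfin := isFiniteKernel_minimalKernel (Q := Q) (t := t) hc hc0
  have hterm : ∀ f, BoundedMeasurable f → ∀ x,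
      ∫ y, f y ∂minimalKernel Q (fun x => C * V x) t (t, x) = f x := fun f hf x => by
    obtain ⟨hf, B, hB⟩ := hf
    simp [integral_minimalKernel hc hc0 hf hB le_rfl]
  refine ⟨fun s => (minimalKernel Q (fun x => C * V x) t).comap (fun x => (s, x))
    measurable_prodMk_left, fun s hs => ⟨fun x => ⟨?_⟩⟩, ?_, fun s hs x => ?_, hsol⟩
  · have h1 : BoundedMeasurable fun _ : E => (1 : ℝ) := ⟨measurable_const, 1, by simp⟩
    -- Non-explosion: the total mass and the constant 1 solve the same terminal value problem.
    have h2 := (hsol _ h1).unique h (IsBackwardSolution.const 1) (fun x => hterm _ h1 x) hs x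
    rw [integral_const, smul_eq_mul, mul_one] at h2
    rw [Kernel.comap_apply, ← ofReal_measureReal, h2, ENNReal.ofReal_one]
  · refine Kernel.ext fun x => Measure.ext fun A hA => ?_
    have h1 : BoundedMeasurable (A.indicator (1 : E → ℝ)) :=
      ⟨measurable_one.indicator hA, 1, fun y => by by_cases hy : y ∈ A <;> simp [hy]⟩
    have h2 := hterm _ h1 x
    rw [integral_indicator_one hA] at h2
    rw [Kernel.comap_apply, ← ofReal_measureReal, h2, Kernel.id_apply, Measure.dirac_apply' _ hA]
    by_cases hx : x ∈ A <;> simp [hx]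
  · have hV0 : ∀ y, 0 ≤ V y := fun y => by linarith [h.one_le y]
    refine ⟨h.measurable_V.aestronglyMeasurable, ?_⟩
    rw [hasFiniteIntegral_iff_ofReal (ae_of_all _ hV0), Kernel.comap_apply]
    refine (lintegral_mono fun y => ENNReal.ofReal_le_ofReal (h.V_le_W y)).trans_lt ?_
    exact (h.lintegral_minimalKernel_W_le hQ hs x).trans_lt
      (ENNReal.mul_lt_top ENNReal.ofReal_lt_top ENNReal.ofReal_lt_top)

end TransitionKernel

/-! ### The inhomogeneous process: uniqueness, forward equation, existence -/

section InhomogeneousProcess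

theorem tendsto_add_nhdsGT_zero (s : ℝ) : Tendsto (fun ε : ℝ => s + ε) (𝓝[>] 0) (𝓝[>] s) := by
  refine tendsto_nhdsWithin_iff.2 ⟨?_, ?_⟩
  · have : Tendsto (fun ε : ℝ => s + ε) (𝓝 0) (𝓝 (s + 0)) := tendsto_id.const_add s
    rw [add_zero] at this
    exact this.mono_left nhdsWithin_le_nhds
  · filter_upwards [self_mem_nhdsWithin] with ε hε using by simpa using hε

theorem tendsto_sub_nhdsGT (s : ℝ) : Tendsto (fun r : ℝ => r - s) (𝓝[>] s) (𝓝[>] 0) := by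
  refine tendsto_nhdsWithin_iff.2 ⟨?_, ?_⟩
  · have : Tendsto (fun r : ℝ => r - s) (𝓝 s) (𝓝 (s - s)) := tendsto_id.sub_const s
    rw [sub_self] at this
    exact this.mono_left nhdsWithin_le_nhds
  · filter_upwards [self_mem_nhdsWithin] with r hr using by simpa using hr

theorem hasDerivWithinAt_Ici_iff_tendsto {g : ℝ → ℝ} {g' s : ℝ} :
    HasDerivWithinAt g g' (Ici s) s ↔
      Tendsto (fun ε => (g (s + ε) - g s) / ε) (𝓝[>] 0) (𝓝 g') := by
  rw [← hasDerivWithinAt_Ioi_iff_Ici, hasDerivWithinAt_iff_tendsto_slope' self_notMem_Ioi]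
  constructor
  · intro h
    refine (h.comp (tendsto_add_nhdsGT_zero s)).congr fun ε => ?_
    simp [slope_def_field]
  · intro h
    refine (h.comp (tendsto_sub_nhdsGT s)).congr fun r => ?_
    simp [slope_def_field]

variable {E : Type*} [MeasurableSpace E] {q : ℝ → Kernel E E} {V W : E → ℝ} {C T t : ℝ}

theorem measurable_act {P : Kernel E E} {f : E → ℝ} (hf : Measurable f) : Measurable (act P f) :=
  (StronglyMeasurable.integral_kernel hf.stronglyMeasurable).measurable

theorem abs_act_le {P : Kernel E E} (hP : IsMarkovKernel P) {f : E → ℝ} {B : ℝ}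
    (hB : ∀ x, |f x| ≤ B) (x : E) : |act P f x| ≤ B := by
  simpa [act] using norm_integral_le_of_norm_le_const (μ := P x) (f := f) (ae_of_all _ hB)

theorem act_comp {P R : Kernel E E} (hP : IsMarkovKernel P) (hR : IsMarkovKernel R) {f : E → ℝ}
    (hf : BoundedMeasurable f) (x : E) : act (R ∘ₖ P) f x = act P (act R f) x := by
  obtain ⟨hf, B, hB⟩ := hf
  exact Kernel.integral_comp (integrable_of_abs_le hf hB)

theorem act_id {f : E → ℝ} (hf : Measurable f) (x : E) : act Kernel.id f x = f x := by
  rw [act, Kernel.id_apply, integral_dirac' _ _ hf.stronglyMeasurable]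

theorem boundedMeasurable_indicator {A : Set E} (hA : MeasurableSet A) :
    BoundedMeasurable (A.indicator (1 : E → ℝ)) :=
  ⟨measurable_one.indicator hA, 1, fun y => by by_cases hy : y ∈ A <;> simp [hy]⟩

theorem BoundedMeasurable.act {P : Kernel E E} (hP : IsMarkovKernel P) {f : E → ℝ}
    (hf : BoundedMeasurable f) : BoundedMeasurable (act P f) := by
  obtain ⟨hf, B, hB⟩ := hf
  exact ⟨measurable_act hf, B, abs_act_le hP hB⟩

theorem kernel_ext_of_act {P R : Kernel E E} (hP : IsMarkovKernel P) (hR : IsMarkovKernel R)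
    (h : ∀ f, BoundedMeasurable f → ∀ x, act P f x = act R f x) : P = R := by
  refine Kernel.ext fun x => Measure.ext fun A hA => ?_
  have h1 := h _ (boundedMeasurable_indicator hA) x
  rw [act, act, integral_indicator_one hA, integral_indicator_one hA] at h1
  rw [← ofReal_measureReal, h1, ofReal_measureReal]

theorem measurable_gen {Q : Kernel E E} (hQ : ∀ x, IsFiniteMeasure (Q x)) {f : E → ℝ}
    (hf : BoundedMeasurable f) : Measurable (gen Q f) := by
  obtain ⟨hf, B, hB⟩ := hf
  have h1 : gen Q f = fun x => act Q f x - (Q x univ).toReal * f x :=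
    funext fun x => gen_eq (integrable_of_abs_le hf hB)
  rw [h1]
  exact (measurable_act hf).sub ((Q.measurable_coe MeasurableSet.univ).ennreal_toReal.mul hf)

/-- Only the mass moved away from x contributes. This turns the jump condition into continuity in
time. -/
theorem abs_act_sub_le [MeasurableSingletonClass E] {P : Kernel E E} (hP : IsMarkovKernel P)
    {f : E → ℝ} (hf : Measurable f) {B : ℝ} (hB : ∀ x, |f x| ≤ B) (x : E) :
    |act P f x - f x| ≤ 2 * B * (1 - (P x).real {x}) := by
  have h1 : act P f x - f x = ∫ y in {x}ᶜ, (f y - f x) ∂P x := by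
    rw [setIntegral_eq_integral_of_forall_compl_eq_zero (fun y hy => by
      rw [notMem_compl_iff, mem_singleton_iff] at hy; rw [hy, sub_self]),
      integral_sub (integrable_of_abs_le hf hB) (integrable_const _)]
    simp [act]
  rw [h1, ← probReal_compl_eq_one_sub (measurableSet_singleton x)]
  refine norm_setIntegral_le_of_norm_le_const (f := fun y => f y - f x)
    (measure_lt_top (P x) _) fun y _ => ?_
  rw [Real.norm_eq_abs]
  linarith [abs_sub (f y) (f x), hB y, hB x]

/-- The right derivative gives only right continuity. Left continuity at s comes from P_{r,t} f -
P_{s,t} f = (P_{r,s} - 1) P_{s,t} f for r < s and the jump condition as r ↑ s. -/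
theorem IsGeneratedBy.isBackwardSolution [MeasurableSingletonClass E] {P : ℝ → ℝ → Kernel E E}
    (h : IsGeneratedBy q P) (t : ℝ) {f : E → ℝ} (hf : BoundedMeasurable f) :
    IsBackwardSolution q t fun s => act (P s t) f := by
  have hderiv : ∀ x, ∀ s ∈ Ico 0 t, HasDerivWithinAt (fun r => act (P r t) f x)
      (-gen (q s) (act (P s t) f) x) (Ici s) s := fun x s hs =>
    hasDerivWithinAt_Ici_iff_tendsto.2 (h.backward f hf s t hs.1 hs.2 x)
  obtain ⟨hfm, B, hB⟩ := hf
  refine ⟨fun s _ => measurable_act hfm, ⟨B, fun s hs => abs_act_le (h.markov s t hs.1 hs.2) hB⟩,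
    fun x s hs => ?_, hderiv⟩
  rw [← Icc_union_Icc_eq_Icc hs.1 hs.2, continuousWithinAt_union]
  constructor
  · rcases hs.1.eq_or_lt with rfl | hs0
    · simp
    · refine ContinuousWithinAt.mono (continuousWithinAt_Iio_iff_Iic.1 ?_) Icc_subset_Iic_self
      set g := act (P s t) f with hg
      have hgB : ∀ y, |g y| ≤ B := abs_act_le (h.markov s t hs.1 hs.2) hB
      have hjump : Tendsto (fun r => 2 * B * (1 - (P r s x).real {x})) (𝓝[<] s) (𝓝 0) := by
        have h1 := (ENNReal.tendsto_toReal ENNReal.one_ne_top).comp (h.jump_left s hs0 x)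
        simpa [measureReal_def] using (h1.const_sub 1).const_mul (2 * B)
      refine tendsto_iff_norm_sub_tendsto_zero.2
        (squeeze_zero' (Eventually.of_forall fun _ => norm_nonneg _) ?_ hjump)
      filter_upwards [Ioo_mem_nhdsLT hs0] with r hr
      have hm := h.markov r s hr.1.le hr.2.le
      rw [h.semigroup r s t hr.1.le hr.2.le hs.2,
        act_comp hm (h.markov s t hs.1 hs.2) ⟨hfm, B, hB⟩]
      exact abs_act_sub_le hm (measurable_act hfm) hgB x
  · rcases hs.2.eq_or_lt with rfl | hst
    · simp
    · exact (hderiv x s ⟨hs.1, hst⟩).continuousWithinAt.mono Icc_subset_Ici_self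

theorem IsGeneratedBy.unique [MeasurableSingletonClass E] {P P' : ℝ → ℝ → Kernel E E}
    (h : IsGeneratedBy q P) (h' : IsGeneratedBy q P')
    (hL : ∀ T, 0 ≤ T → ∃ C, IsLyapunovOn q V W C T) {s t : ℝ} (hs : 0 ≤ s) (hst : s ≤ t) :
    P' s t = P s t := by
  obtain ⟨C, hC⟩ := hL t (hs.trans hst)
  refine kernel_ext_of_act (h'.markov s t hs hst) (h.markov s t hs hst) fun f hf x => ?_
  refine (h'.isBackwardSolution t hf).unique hC (h.isBackwardSolution t hf) (fun y => ?_)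
    ⟨hs, hst⟩ x
  rw [h.refl t (hs.trans hst), h'.refl t (hs.trans hst)]

theorem IsStableConservative.exists_isLyapunovOn [MeasurableSingletonClass E]
    (hq : IsStableConservative q) (hL : LyapunovCondition q) :
    ∃ V W : E → ℝ, ∀ T, 0 ≤ T → ∃ C, IsLyapunovOn q V W C T := by
  obtain ⟨V, K, θ, hV, hV1, hK, hK0, hθ, H⟩ := hL
  refine ⟨V, fun x => V x ^ θ, fun T hT => ?_⟩
  obtain ⟨a, ha, hmax⟩ := isCompact_Icc.exists_isMaxOn (nonempty_Icc.2 hT)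
    (hK.mono Icc_subset_Ici_self)
  refine ⟨K a, hV, hV.pow_const θ, hV1, fun x => Real.self_le_rpow_of_one_le (hV1 x) hθ.le,
    hK0 a ha.1, fun t ht => hq.finite t ht.1, fun t ht x => ?_, fun t ht x => (H t ht.1 x).2.1,
    fun t ht x => ?_⟩
  · have := hq.finite t ht.1 x
    -- The rate omits {x}, which carries no mass.
    have h1 : (q t x).real univ = rate (q t) x := by
      rw [rate, measureReal_compl (measurableSet_singleton x)]
      simp [measureReal_def, hq.no_self_jump t ht.1 x]
    rw [h1]
    exact (H t ht.1 x).1.trans (mul_le_mul_of_nonneg_right (hmax ht) (by linarith [hV1 x]))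
  · exact (H t ht.1 x).2.2.trans (mul_le_mul_of_nonneg_right (hmax ht)
      (Real.rpow_nonneg (by linarith [hV1 x]) _))

theorem TimeContinuous.isTVContinuousOn (hq : TimeContinuous q) (T : ℝ) : IsTVContinuousOn q T := by
  -- The time continuity hypothesis needs a positive horizon, hence the maximum with 1.
  refine IsTVContinuousOn.mono (T := max T 1) ?_ (le_max_left _ _)
  intro x δ hδ
  have h1 := (hq (max T 1) (by positivity) x).eventually_lt_const (ENNReal.ofReal_pos.2 hδ)
  obtain ⟨η, hη, hη0⟩ := (h1.and self_mem_nhdsWithin).exists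
  refine ⟨η, hη0, fun s hs t ht hst f hf hf1 => ?_⟩
  refine (ENNReal.ofReal_le_ofReal_iff hδ.le).1 (le_trans ?_ hη.le)
  have h2 : ENNReal.ofReal |(∫ y, f y ∂q t x) - ∫ y, f y ∂q s x| ≤ tvDist (q t x) (q s x) :=
    le_iSup₂ (f := fun (f : E → ℝ) (_ : Measurable f ∧ ∀ x, |f x| ≤ 1) =>
      ENNReal.ofReal |(∫ y, f y ∂q t x) - ∫ y, f y ∂q s x|) f ⟨hf, hf1⟩
  exact h2.trans (le_iSup₂_of_le s hs (le_iSup₂_of_le t ht (le_iSup_of_le hst le_rfl)))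

/-- Solutions of the backward equation with terminal value `f` at time `τ ↓ t` have right
derivative `L_t f` in `τ`. -/
theorem IsLyapunovOn.tendsto_slope_terminal (h : IsLyapunovOn q V W C T)
    (hq : IsTVContinuousOn q T) (ht : 0 ≤ t) (htT : t < T) {f : E → ℝ} (hf : Measurable f)
    {u : ℝ → ℝ → E → ℝ} (hu : ∀ τ ∈ Ioc t T, IsBackwardSolution q τ (u τ)) {B : ℝ}
    (hB : ∀ τ ∈ Ioc t T, ∀ s ∈ Icc 0 τ, ∀ x, |u τ s x| ≤ B) (huf : ∀ τ ∈ Ioc t T, u τ τ = f)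
    (x : E) :
    Tendsto (fun ε : ℝ => (u (t + ε) t x - f x) / ε) (𝓝[>] 0) (𝓝 (gen (q t) f x)) := by
  have htI : t ∈ Icc 0 T := ⟨ht, htT.le⟩
  have := h.finite t htI x
  have hTI : T ∈ Ioc t T := right_mem_Ioc.2 htT
  have hBf : ∀ y, |f y| ≤ B := fun y => by
    rw [← huf T hTI]; exact hB T hTI T (right_mem_Icc.2 (ht.trans htT.le)) y
  have hB0 : 0 ≤ B := (abs_nonneg _).trans (hBf x)
  have hC := h.pos
  have hV : ∀ y, 0 ≤ V y := fun y => by linarith [h.one_le y]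
  set A := ∫ y, (2 * B * (C * V y) + 2 * B * (C * V x)) ∂q t x with hA
  have hAint : Integrable (fun y => 2 * B * (C * V y) + 2 * B * (C * V x)) (q t x) :=
    (((h.integrable_V htI x).const_mul C).const_mul (2 * B)).add (integrable_const _)
  rw [Metric.tendsto_nhds]
  intro δ hδ
  obtain ⟨η, hη, Hη⟩ := hq.exists_abs_sub_le x (2 * B) (half_pos hδ)
  have hsmall : ∀ᶠ ε : ℝ in 𝓝[>] 0, ε * A < δ / 2 := by
    have h1 : Tendsto (fun ε : ℝ => ε * A) (𝓝 0) (𝓝 (0 * A)) := tendsto_id.mul_const A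
    rw [zero_mul] at h1
    exact (h1.mono_left nhdsWithin_le_nhds).eventually_lt_const (half_pos hδ)
  filter_upwards [hsmall, Ioc_mem_nhdsGT hη, Ioc_mem_nhdsGT (sub_pos.2 htT)] with ε hεA hεη hεT
  have hε0 : 0 < ε := hεη.1
  have hτ : t + ε ∈ Ioc t T := ⟨by linarith, by linarith [hεT.2]⟩
  have hLτ := h.mono hτ.2
  set L := gen (q t) f x
  have hsol := hu _ hτ
  -- Mean value inequality on [t, t + ε]: the derivative L_t f - L_r u_r is at most δ/2 + ε A, where
  -- ε A pays for replacing u_r by its terminal value f and δ/2 for replacing q_r by q_t.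
  have key := norm_image_sub_le_of_norm_deriv_right_le_segment
    (f := fun r => u (t + ε) r x + (r - t) * L) (a := t) (b := t + ε)
    (f' := fun r => -gen (q r) (u (t + ε) r) x + L) (C := δ / 2 + ε * A)
    (((hsol.continuousOn x).mono (Icc_subset_Icc_left ht)).add (by fun_prop))
    (fun r hr => (hsol.hasDeriv x r ⟨ht.trans hr.1, hr.2⟩).add (by
      simpa using (((hasDerivAt_id r).sub_const t).mul_const L).hasDerivWithinAt))
    (fun r hr => ?_) (t + ε) (right_mem_Icc.2 hτ.1.le)
  · rw [huf _ hτ] at key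
    simp only [sub_self, zero_mul, add_zero, add_sub_cancel_left, Real.norm_eq_abs] at key
    rw [Real.dist_eq, div_sub' hε0.ne', abs_div, abs_of_pos hε0, div_lt_iff₀ hε0]
    calc |u (t + ε) t x - f x - ε * L| = |f x + ε * L - u (t + ε) t x| := by
          rw [abs_sub_comm]; congr 1; ring
      _ ≤ (δ / 2 + ε * A) * ε := key
      _ < δ * ε := mul_lt_mul_of_pos_right (by linarith) hε0
  · have hrτ : r ∈ Icc 0 (t + ε) := ⟨ht.trans hr.1, hr.2.le⟩
    have hrT : r ∈ Icc 0 T := ⟨hrτ.1, hrτ.2.trans hτ.2⟩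
    have := h.finite r hrT x
    set w := u (t + ε) r with hw
    have hwm : Measurable w := hsol.measurable r hrτ
    have hwB : ∀ y, |w y| ≤ B := hB _ hτ r hrτ
    have e1 : |L - gen (q t) w x| ≤ ε * A := by
      rw [← gen_sub (integrable_of_abs_le hf hBf) (integrable_of_abs_le hwm hwB), hA,
        ← integral_const_mul]
      refine (abs_integral_le_integral_abs).trans
        (integral_mono_of_nonneg (ae_of_all _ fun y => abs_nonneg _) (hAint.const_mul ε)
          (ae_of_all _ fun y => ?_))
      -- The Lipschitz bound is not uniform in z, but it is a multiple of V, which is integrable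
      -- under q_t(x, ·); A is the resulting integral.
      have hd : ∀ z, |f z - w z| ≤ 2 * B * (C * V z) * ε := fun z => by
        have h1 := hsol.abs_sub_le hLτ (hB _ hτ) hrτ z
        rw [huf _ hτ] at h1
        refine h1.trans (mul_le_mul_of_nonneg_left (by linarith [hr.1]) ?_)
        have := hV z
        positivity
      beta_reduce
      linarith [abs_sub (f y - w y) (f x - w x), hd y, hd x]
    have e2 : |gen (q t) w x - gen (q r) w x| ≤ δ / 2 := by
      refine Hη r hrT t htI ?_ (fun y => w y - w x) (hwm.sub_const _) fun y => ?_
      · rw [abs_sub_comm, abs_of_nonneg (by linarith [hr.1])]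
        linarith [hr.2, hεη.2]
      · linarith [abs_sub (w y) (w x), hwB y, hwB x]
    rw [Real.norm_eq_abs, neg_add_eq_sub]
    linarith [abs_sub_le L (gen (q t) w x) (gen (q r) w x)]

/-- The kernels are chosen separately for each terminal time; uniqueness for the backward equation
makes them consistent. -/
theorem exists_isGeneratedBy [MeasurableSingletonClass E]
    (hL : ∀ T, 0 ≤ T → ∃ C, IsLyapunovOn q V W C T) (hq : ∀ T, IsTVContinuousOn q T) :
    ∃ P : ℝ → ℝ → Kernel E E, IsGeneratedBy q P := by
  have hex : ∀ t, ∃ P : ℝ → Kernel E E, 0 ≤ t →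
      (∀ s ∈ Icc 0 t, IsMarkovKernel (P s)) ∧ P t = Kernel.id ∧
      (∀ s ∈ Icc 0 t, ∀ x, Integrable V (P s x)) ∧
      ∀ f, BoundedMeasurable f → IsBackwardSolution q t fun s => act (P s) f := by
    intro t
    by_cases ht : 0 ≤ t
    · obtain ⟨C, hC⟩ := hL t ht
      obtain ⟨P, hP⟩ := hC.exists_transitionKernel ht (hq t)
      exact ⟨P, fun _ => hP⟩
    · exact ⟨fun _ => 0, fun h => absurd h ht⟩
  choose R hR using hex
  have hmarkov : ∀ s t, 0 ≤ s → s ≤ t → IsMarkovKernel (R t s) := fun s t hs hst =>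
    (hR t (hs.trans hst)).1 s ⟨hs, hst⟩
  have hrefl : ∀ t, 0 ≤ t → R t t = Kernel.id := fun t ht => (hR t ht).2.1
  have hsol : ∀ t, 0 ≤ t → ∀ f, BoundedMeasurable f →
      IsBackwardSolution q t fun s => act (R t s) f := fun t ht => (hR t ht).2.2.2
  have hsemi : ∀ s r t, 0 ≤ s → s ≤ r → r ≤ t → R t s = R t r ∘ₖ R r s := by
    intro s r t hs hsr hrt
    have hr : 0 ≤ r := hs.trans hsr
    obtain ⟨C, hC⟩ := hL r hr
    have m1 := hmarkov s r hs hsr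
    have m2 := hmarkov r t hr hrt
    refine kernel_ext_of_act (hmarkov s t hs (hsr.trans hrt)) inferInstance fun f hf x => ?_
    rw [act_comp m1 m2 hf]
    -- Chapman–Kolmogorov: on [0, r] both sides solve the backward equation with terminal value
    -- P_{r,t} f at time r.
    refine ((hsol t (hr.trans hrt) f hf).mono hrt).unique hC (hsol r hr _ (hf.act m2))
      (fun y => ?_) ⟨hs, hsr⟩ x
    rw [hrefl r hr, act_id (measurable_act hf.1)]
  have habs : ∀ {C T}, IsLyapunovOn q V W C T → ∀ {s t}, 0 ≤ s → s ≤ t → t ≤ T → ∀ {f : E → ℝ} {B},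
      Measurable f → (∀ y, |f y| ≤ B) → ∀ x,
      |act (R t s) f x - f x| ≤ 2 * B * (C * V x) * (t - s) := by
    intro C T hC s t hs hst htT f B hf hB x
    have ht : 0 ≤ t := hs.trans hst
    have h1 := (hsol t ht f ⟨hf, B, hB⟩).abs_sub_le (hC.mono htT) (B := B)
      (fun r hr => abs_act_le (hmarkov r t hr.1 hr.2) hB) ⟨hs, hst⟩ x
    rwa [hrefl t ht, act_id hf, abs_sub_comm] at h1
  have hstay : ∀ {C T}, IsLyapunovOn q V W C T → ∀ {s t}, 0 ≤ s → s ≤ t → t ≤ T → ∀ x,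
      ENNReal.ofReal (1 - 2 * (C * V x) * (t - s)) ≤ R t s x {x} := by
    intro C T hC s t hs hst htT x
    have := hmarkov s t hs hst
    -- The Lipschitz bound applied to the indicator of {x} controls the probability of having left
    -- x, and so gives both jump conditions.
    have h1 := habs hC hs hst htT (f := ({x} : Set E).indicator 1) (B := 1)
      (boundedMeasurable_indicator (measurableSet_singleton x)).1
      (fun y => by by_cases hy : y ∈ ({x} : Set E) <;> simp [hy]) x
    rw [act, integral_indicator_one (measurableSet_singleton x)] at h1
    simp only [mem_singleton_iff, indicator_of_mem, Pi.one_apply, mul_one] at h1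
    rw [← ofReal_measureReal]
    exact ENNReal.ofReal_le_ofReal (by linarith [neg_abs_le ((R t s x).real {x} - 1)])
  refine ⟨fun s t => R t s, hmarkov, hrefl, fun s hs x => ?_, fun t ht x => ?_, hsemi,
    fun f hf s t hs hst x => ?_, fun f hf s t hs hst x => ?_⟩
  · obtain ⟨C, hC⟩ := hL (s + 1) (by linarith)
    have h1 : Tendsto (fun t => ENNReal.ofReal (1 - 2 * (C * V x) * (t - s))) (𝓝[>] s) (𝓝 1) := by
      have : Continuous fun t => ENNReal.ofReal (1 - 2 * (C * V x) * (t - s)) :=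
        ENNReal.continuous_ofReal.comp (by fun_prop)
      simpa using (this.tendsto s).mono_left nhdsWithin_le_nhds
    refine tendsto_of_tendsto_of_tendsto_of_le_of_le' h1 tendsto_const_nhds ?_ ?_
    · filter_upwards [Ioc_mem_nhdsGT (lt_add_one s)] with t ht using hstay hC hs ht.1.le ht.2 x
    · filter_upwards [self_mem_nhdsWithin] with t ht
      have := hmarkov s t hs (le_of_lt ht)
      exact prob_le_one
  · obtain ⟨C, hC⟩ := hL t ht.le
    have h1 : Tendsto (fun s => ENNReal.ofReal (1 - 2 * (C * V x) * (t - s))) (𝓝[<] t) (𝓝 1) := by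
      have : Continuous fun s => ENNReal.ofReal (1 - 2 * (C * V x) * (t - s)) :=
        ENNReal.continuous_ofReal.comp (by fun_prop)
      simpa using (this.tendsto t).mono_left nhdsWithin_le_nhds
    refine tendsto_of_tendsto_of_tendsto_of_le_of_le' h1 tendsto_const_nhds ?_ ?_
    · filter_upwards [Ico_mem_nhdsLT ht] with s hs using hstay hC hs.1 hs.2.le le_rfl x
    · filter_upwards [Ico_mem_nhdsLT ht] with s hs
      have := hmarkov s t hs.1 hs.2.le
      exact prob_le_one
  · exact hasDerivWithinAt_Ici_iff_tendsto.1
      ((hsol t (hs.trans hst.le) f hf).hasDeriv x s ⟨hs, hst⟩)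
  · have ht : 0 ≤ t := hs.trans hst.le
    obtain ⟨C, hC⟩ := hL (t + 1) (by linarith)
    obtain ⟨hfm, B, hB⟩ := id hf
    have htI : t ∈ Icc 0 (t + 1) := ⟨ht, by linarith⟩
    have hm := hmarkov s t hs hst.le
    have hB0 : 0 ≤ B := (abs_nonneg _).trans (hB x)
    have hC0 := hC.pos
    have hdom : Integrable (fun y => 2 * B * (C * V y)) (R t s x) :=
      (((hR t ht).2.2.1 s ⟨hs, hst.le⟩ x).const_mul C).const_mul (2 * B)
    refine ⟨hdom.mono' (measurable_gen (hC.finite t htI) hf).aestronglyMeasurable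
      (ae_of_all _ fun y => ?_), ?_⟩
    · have := hC.finite t htI y
      exact (abs_gen_le hB).trans (mul_le_mul_of_nonneg_left (hC.mass_le t htI y) (by positivity))
    · have hlim : Tendsto (fun ε : ℝ => ∫ y, (act (R (t + ε) t) f y - f y) / ε ∂(R t s x)) (𝓝[>] 0)
          (𝓝 (∫ y, gen (q t) f y ∂(R t s x))) := by
        refine tendsto_integral_filter_of_dominated_convergence (fun y => 2 * B * (C * V y))
          (Eventually.of_forall fun ε =>
            (((measurable_act hfm).sub hfm).div_const ε).aestronglyMeasurable) ?_ hdom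
          (ae_of_all _ fun y => ?_)
        · filter_upwards [Ioc_mem_nhdsGT one_pos] with ε hε
          refine ae_of_all _ fun y => ?_
          rw [Real.norm_eq_abs, abs_div, abs_of_pos hε.1, div_le_iff₀ hε.1]
          simpa using habs hC (t := t + ε) ht (by linarith [hε.1]) (by linarith [hε.2]) hfm hB y
        · exact hC.tendsto_slope_terminal (hq _) ht (lt_add_one t) hfm
            (u := fun τ r => act (R τ r) f) (fun τ hτ => hsol τ (ht.trans hτ.1.le) f hf)
            (fun τ hτ r hr => abs_act_le (hmarkov r τ hr.1 hr.2) hB)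
            (fun τ hτ => by
              rw [hrefl τ (ht.trans hτ.1.le)]
              exact funext fun y => act_id hfm y) y
      refine hlim.congr' ?_
      filter_upwards [self_mem_nhdsWithin] with ε hε
      have hε0 : 0 < ε := hε
      have hm' := hmarkov t (t + ε) ht (by linarith)
      rw [integral_div, hsemi s t (t + ε) hs hst.le (by linarith), act_comp hm hm' hf,
        integral_sub (integrable_of_abs_le (measurable_act hfm) (abs_act_le hm' hB))
          (integrable_of_abs_le hfm hB)]
      rfl

end InhomogeneousProcess

end JumpProcess

end

theorem theorem5p1 {E : Type*} [TopologicalSpace E] [PolishSpace E] [LocallyCompactSpace E]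
    [MeasurableSpace E] [BorelSpace E] (q : ℝ → Kernel E E)
    (hq : JumpProcess.IsStableConservative q)
    (hA1 : JumpProcess.FrozenWellPosed q)
    (hA2 : JumpProcess.TimeContinuous q)
    (hA3 : JumpProcess.LyapunovCondition q) :
    ∃ P : ℝ → ℝ → Kernel E E, JumpProcess.IsGeneratedBy q P ∧
      ∀ P' : ℝ → ℝ → Kernel E E, JumpProcess.IsGeneratedBy q P' →
        ∀ s t : ℝ, 0 ≤ s → s ≤ t → P' s t = P s t := by
  obtain ⟨V, W, hL⟩ := hq.exists_isLyapunovOn hA3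
  obtain ⟨P, hP⟩ := JumpProcess.exists_isGeneratedBy hL hA2.isTVContinuousOn
  exact ⟨P, hP, fun P' hP' s t hs hst => hP.unique hP' hL hs hst⟩
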